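/- **Setting.** Let $\mathbb K\in\{\mathbb R,\mathbb C\}$. Let $(\mathbb X,\rho)$ be a quasi-metric space with the topology induced by $\rho$ (that is, $\rho\ge 0$ is symmetric, $\rho(x,y)=0$ if and only if $x=y$, $\rho(x,z)\le\kappa(\rho(x,y)+\rho(y,z))$ for some constant $\kappa\ge 1$, and $U$ is open if and only if each $x\in U$ has an $\varepsilon>0$ with $\{y:\rho(x,y)<\varepsilon\}\subset U$). Let $\mu$ be a Borel probability measure on $\mathbb X$. Let $(\varphi_k)_{k\ge 0}$ be an orthonormal basis of $L_2(\mathbb X,\mu)$ that consists of continuous $\mathbb K$-valued functions with $\varphi_0\equiv 1$, and let $(\lambda_k)_{k\ge 0}$ be a nondecreasing real sequence with $\lambda_0=0$ and $\lambda_k\to\infty$. Put $B_t(x)=\{y:\rho(x,y)\le t\}$ and $$G_t(x,y)=\sum_{k=0}^\infty e^{-\lambda_k^2t}\varphi_k(x)\overline{\varphi_k(y)}.$$ Suppose that $\mathbb X$ is a diffusion measure space with exponent $\alpha>0$: there are constants $c_0,C_0>0$ such that 1. for all $x\in\mathbb X$, $t>0$, the ball $B_t(x)$ is compact and $\mu(B_t(x))\le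 C_0t^\alpha$; 2. $|G_t(x,y)|\le C_0t^{-\alpha/2}\exp(-c_0\rho(x,y)^2/t)$ for all $x,y\in\mathbb X$, $0<t\le 1$; 3. $t^{-\alpha/2}\le C_0G_t(x,x)$ for all $x\in\mathbb X$, $0<t<1$ (in particular the series converges). For $N>0$ let $\Pi_N=\operatorname{span}\{\varphi_k:\lambda_k\le N\}$. Suppose also that the strong product assumption holds: there is $a>0$ such that $fg\in\Pi_{aN}$ whenever $f,g\in\Pi_N$ and $N\in\{1,2,4,8,\dots\}$. For $1\le p\le\infty$, $s>0$ and $r>0$ let $$\overline{W^s_r}(L_p(\mathbb X))=\Bigl\{f\in L_p(\mathbb X):\ \|f\|_{L_p}+\sup_{N\in\{1,2,4,8,\dots\}}N^s\inf_{g\in\Pi_N}\|f-g\|_{L_p}\le r\Bigr\}.$$ For a subset $Y$ of a normed space $X$ and $n\ge 1$, the Kolmogorov, linear, Gelfand and Bernstein $n$-widths of $Y$ in $X$ are $$\mathscr K_n=\inf_{\dim L=n}\ \sup_{y\in Y}\ \inf_{x\in L}\|x-y\|,\qquad \mathscr L_n=\inf_{F}\ \sup_{x\in Y}\|x-F(x)\|,$$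 $$\mathscr G_n=\inf_{M}\ \sup_{x\in Y\cap M}\|x\|,\qquad \mathscr B_n=\sup_{\dim Z\ge n+1}\ \sup\{\lambda\ge 0:\ \lambda\overline Z\subset Y\},$$ where $L$ and $Z$ are linear subspaces of $X$, $F$ runs through the bounded linear operators on $X$ whose range has dimension at most $n$, $M$ runs through the closed subspaces of $X$ of codimension at most $n$, and $\overline Z$ is the closed unit ball of $Z$. **Theorem.** Let $1\le p\le\infty$ and $s>0$. There are constants $c,C>0$, independent of $n$ and $r$, such that for all $r>0$ and all integers $n\ge 1$ each of the four $n$-widths $\mathscr K_n,\mathscr L_n,\mathscr G_n,\mathscr B_n$ of $\overline{W^s_r}(L_p(\mathbb X))$ in $L_p(\mathbb X)$ lies between $c\,r\,n^{-s/\alpha}$ and $C\,r\,n^{-s/\alpha}$: $$r\,n^{-s/\alpha}\asymp\mathscr K_n\asymp\mathscr L_n\asymp\mathscr G_n\asymp\mathscr B_n .$$ -/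

import Mathlib

open MeasureTheory Filter Topology
open scoped ENNReal NNReal ComplexConjugate

noncomputable section

/-- `ρ` is a quasi-metric on `X` (a metric up to a constant `κ` in the triangle inequality), and the
topology of `X` is the one that `ρ` induces. -/
structure IsQuasiMetric {X : Type*} [TopologicalSpace X] (ρ : X → X → ℝ) : Prop where
  nonneg : ∀ x y, 0 ≤ ρ x y
  eq_zero_iff : ∀ x y, ρ x y = 0 ↔ x = y
  symm : ∀ x y, ρ x y = ρ y x
  triangle : ∃ κ : ℝ, 1 ≤ κ ∧ ∀ x y z, ρ x z ≤ κ * (ρ x y + ρ y z)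
  isOpen_iff : ∀ U : Set X, IsOpen U ↔ ∀ x ∈ U, ∃ ε > 0, {y | ρ x y < ε} ⊆ U

/-- The generalized heat kernel `∑ₖ exp (-λₖ² t) φₖ(x) φₖ(y)*`. The conjugation is void for
real-valued `φₖ`. -/
def heatKernel {𝕜 X : Type*} [RCLike 𝕜] (φ : ℕ → X → 𝕜) (lam : ℕ → ℝ) (t : ℝ) (x y : X) : 𝕜 :=
  ∑' k, ((Real.exp (-(lam k) ^ 2 * t) : ℝ) : 𝕜) * φ k x * conj (φ k y)

/-- A diffusion measure space of exponent `α`: a quasi-metric space `(X, ρ)` with a Borel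
probability measure `μ` (see the instance arguments), an orthonormal basis `φ` of `L₂(X, μ)` that
consists of continuous functions, and a nondecreasing sequence `lam`.
The field `heat_lower` includes the convergence of the heat series on the diagonal (a divergent
series of nonnegative terms has the `tsum` zero), hence its absolute convergence everywhere. -/
structure IsDiffusionMeasureSpace {𝕜 X : Type*} [RCLike 𝕜] [TopologicalSpace X]
    [MeasurableSpace X] [BorelSpace X] (ρ : X → X → ℝ) (μ : Measure X) [IsProbabilityMeasure μ]
    (φ : ℕ → X → 𝕜) (lam : ℕ → ℝ) (α : ℝ) : Prop where
  quasiMetric : IsQuasiMetric ρ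
  continuous : ∀ k, Continuous (φ k)
  memLp : ∀ k, MemLp (φ k) 2 μ
  orthonormal : Orthonormal 𝕜 (fun k => (memLp k).toLp (φ k))
  complete : (Submodule.span 𝕜 (Set.range fun k => (memLp k).toLp (φ k))).topologicalClosure = ⊤
  phi_zero : ∀ x, φ 0 x = 1
  lam_mono : Monotone lam
  lam_zero : lam 0 = 0
  lam_tendsto : Tendsto lam atTop atTop
  alpha_pos : 0 < α
  isCompact_ball : ∀ x, ∀ t > 0, IsCompact {y | ρ x y ≤ t}
  volume_ball : ∃ C > 0, ∀ x, ∀ t > 0, μ {y | ρ x y ≤ t} ≤ ENNReal.ofReal (C * t ^ α)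
  heat_upper : ∃ c > 0, ∃ C > 0, ∀ x y, ∀ t : ℝ, 0 < t → t ≤ 1 →
    ‖heatKernel φ lam t x y‖ ≤ C * t ^ (-α / 2) * Real.exp (-c * (ρ x y ^ 2 / t))
  heat_lower : ∃ C > 0, ∀ x, ∀ t : ℝ, 0 < t → t < 1 →
    t ^ (-α / 2) ≤ C * RCLike.re (heatKernel φ lam t x x)

/-- The diffusion polynomials of degree at most `N`, as functions on `X`. -/
def diffusionPoly {𝕜 X : Type*} [RCLike 𝕜] (φ : ℕ → X → 𝕜) (lam : ℕ → ℝ) (N : ℝ) :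
    Submodule 𝕜 (X → 𝕜) :=
  Submodule.span 𝕜 (φ '' {k | lam k ≤ N})

/-- The strong product assumption; degrees `N` are powers of two. -/
def StrongProduct {𝕜 X : Type*} [RCLike 𝕜] (φ : ℕ → X → 𝕜) (lam : ℕ → ℝ) : Prop :=
  ∃ a : ℝ, 0 < a ∧ ∀ j : ℕ, ∀ f ∈ diffusionPoly φ lam (2 ^ j), ∀ g ∈ diffusionPoly φ lam (2 ^ j),
    f * g ∈ diffusionPoly φ lam (a * 2 ^ j)

/-- The diffusion polynomials of degree at most `N`, as elements of `Lₚ(X, μ)`. -/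
def diffusionPolyLp {𝕜 X : Type*} [RCLike 𝕜] [MeasurableSpace X] (μ : Measure X)
    (φ : ℕ → X → 𝕜) (lam : ℕ → ℝ) (p : ℝ≥0∞) (N : ℝ) : Set (Lp 𝕜 p μ) :=
  {f | ∃ g ∈ diffusionPoly φ lam N, f =ᵐ[μ] g}

/-- The error of best approximation of `f` by elements of `Y`. -/
def bestError {E : Type*} [NormedAddCommGroup E] (f : E) (Y : Set E) : ℝ≥0∞ :=
  ⨅ g ∈ Y, ‖f - g‖ₑ

/-- The Sobolev norm `‖f‖ₚ + sup_N N ^ s E(f, Π_N)`, where `N` runs through the powers of two;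
it may be infinite. -/
def sobolevNorm {𝕜 X : Type*} [RCLike 𝕜] [MeasurableSpace X] (μ : Measure X)
    (φ : ℕ → X → 𝕜) (lam : ℕ → ℝ) (p : ℝ≥0∞) [Fact (1 ≤ p)] (s : ℝ) (f : Lp 𝕜 p μ) : ℝ≥0∞ :=
  ‖f‖ₑ + ⨆ j : ℕ, ENNReal.ofReal (((2 : ℝ) ^ j) ^ s) *
    bestError f (diffusionPolyLp μ φ lam p (2 ^ j))

/-- The ball of radius `r` of the Sobolev space of order `s`, as a subset of `Lₚ(X, μ)`. -/
def sobolevBall {𝕜 X : Type*} [RCLike 𝕜] [MeasurableSpace X] (μ : Measure X)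
    (φ : ℕ → X → 𝕜) (lam : ℕ → ℝ) (p : ℝ≥0∞) [Fact (1 ≤ p)] (s r : ℝ) : Set (Lp 𝕜 p μ) :=
  {f | sobolevNorm μ φ lam p s f ≤ ENNReal.ofReal r}

section Widths

variable (𝕜 : Type*) {E : Type*} [RCLike 𝕜] [NormedAddCommGroup E] [NormedSpace 𝕜 E]

/-- Kolmogorov `n`-width: infimum over the `n`-dimensional subspaces. -/
def kolmogorovWidth (n : ℕ) (Y : Set E) : ℝ≥0∞ :=
  ⨅ (L : Submodule 𝕜 E) (_ : Module.rank 𝕜 L = n), ⨆ y ∈ Y, ⨅ x ∈ L, ‖x - y‖ₑ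

/-- Linear `n`-width: infimum over the bounded operators of rank at most `n`. -/
def linearWidth (n : ℕ) (Y : Set E) : ℝ≥0∞ :=
  ⨅ (F : E →L[𝕜] E) (_ : Module.rank 𝕜 (LinearMap.range (F : E →ₗ[𝕜] E)) ≤ n),
    ⨆ x ∈ Y, ‖x - F x‖ₑ

/-- Gelfand `n`-width: infimum over the closed subspaces of codimension at most `n`. -/
def gelfandWidth (n : ℕ) (Y : Set E) : ℝ≥0∞ :=
  ⨅ (L : Submodule 𝕜 E) (_ : IsClosed (L : Set E)) (_ : Module.rank 𝕜 (E ⧸ L) ≤ n),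
    ⨆ x ∈ Y ∩ (L : Set E), ‖x‖ₑ

/-- Bernstein `n`-width: supremum over the subspaces of dimension at least `n + 1` of the largest
multiple of their closed unit ball that lies in `Y`. -/
def bernsteinWidth (n : ℕ) (Y : Set E) : ℝ≥0∞ :=
  ⨆ (L : Submodule 𝕜 E) (_ : ((n + 1 : ℕ) : Cardinal) ≤ Module.rank 𝕜 L),
    ⨆ (c : ℝ≥0) (_ : ∀ x ∈ L, ‖x‖ ≤ 1 → ((c : ℝ) : 𝕜) • x ∈ Y), (c : ℝ≥0∞)

end Widths

end

/-!
All four widths are compared with the linear width from above and with a large ball of diffusion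
polynomials from below.

*Lower bounds.* Let `Z` be the space of diffusion polynomials of degree at most `N = 2 ^ j`. The
approximation errors of `z ∈ Z` vanish for degrees from `N` on and are at most `‖z‖` below, so the
Sobolev ball contains the ball of `Z` of radius `r / (1 + N ^ s)` (`mem_sobolevBall_of_norm_le`).
Integrating the bounds for the heat kernel on the diagonal shows that `dim Z` is of the order
`N ^ α` (`exists_ncard_le`, `exists_le_ncard`), hence `dim Z ≥ 6 n` for some `N` of the order
`n ^ (1 / α)`. This bounds the Bernstein width, and with it the Gelfand and the linear width. For the
Kolmogorov width a comparison of volumes (`exists_far_of_six_mul_finrank_le`) replaces the sharp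
theorem of Krein, Krasnoselskii and Milman, which needs Borsuk's theorem; it costs only a
constant.

*Upper bounds.* It suffices to find operators `F` on `Lₚ` of rank `O(N ^ α)`, bounded uniformly in
`N`, that reproduce the polynomials of degree at most `N`: then `‖f - F f‖` is at most a multiple
of the best approximation error. Let `A` be the heat operator at time `t = N⁻²`, with eigenvalues
`u = exp (-λ² t)`. Take `F = A h(A)`, where `h` is smooth, `h(u) = 1 / u` for `u ≥ e⁻¹` and
`h(u) = 0` for `u ≤ e⁻¹ / 2` (`cutoffDiv`). By Schur's test (`eLpNorm_integral_mul_le`) it is enough to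
bound the kernel of `F` in `L₁`. Since `h ∘ cos` is a smooth even periodic function, `h` has a
Chebyshev expansion with rapidly decreasing coefficients (`exists_chebyshev_cutoff`), which
reduces the question to a bound for the kernel of `A Tₘ(A)` in `L₁` that is polynomial in `m`
(`exists_lintegral_polynomial_kernel_le`). The sum of the absolute values of the coefficients of
`Tₘ` is at most `3 ^ m`, and the powers of `A` are heat operators, so the Gaussian bounds make the
kernel negligible outside of a ball of radius `L (m + 1) √t`; inside, `|Tₘ| ≤ 1` gives an `L₂`
bound, and the volume of the ball does the rest.
-/

/-! ### Comparison of the widths -/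

section WidthComparison

open Module

variable {𝕜 E : Type*} [RCLike 𝕜] [NormedAddCommGroup E] [NormedSpace 𝕜 E]

theorem one_le_card_mul_pow_of_ball_subset {V : Type*} [NormedAddCommGroup V] [NormedSpace ℝ V]
    [FiniteDimensional ℝ V] (S : Finset V) {δ : ℝ} (hδ : 0 ≤ δ)
    (h : ∀ x : V, ‖x‖ ≤ 1 → ∃ y ∈ S, ‖x - y‖ ≤ δ) : 1 ≤ (S.card : ℝ) * δ ^ finrank ℝ V := by
  borelize V
  let ν : Measure V := Measure.addHaar
  have hsub : Metric.closedBall (0 : V) 1 ⊆ ⋃ y ∈ S, Metric.closedBall y δ := by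
    intro x hx
    obtain ⟨y, hy, hxy⟩ := h x (by simpa using hx)
    exact Set.mem_biUnion hy (by simpa [dist_eq_norm] using hxy)
  have h1 : ν (Metric.closedBall (0 : V) 1) ≤
      (S.card : ℝ≥0∞) * ENNReal.ofReal (δ ^ finrank ℝ V) * ν (Metric.closedBall (0 : V) 1) := by
    calc ν (Metric.closedBall (0 : V) 1) ≤ ν (⋃ y ∈ S, Metric.closedBall y δ) := measure_mono hsub
      _ ≤ ∑ y ∈ S, ν (Metric.closedBall y δ) := measure_biUnion_finset_le _ _
      _ = ∑ y ∈ S, ENNReal.ofReal (δ ^ finrank ℝ V) * ν (Metric.closedBall (0 : V) 1) := by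
        refine Finset.sum_congr rfl fun y _ => ?_
        rw [Measure.addHaar_closedBall' ν y hδ]
      _ = _ := by rw [Finset.sum_const, nsmul_eq_mul, mul_assoc]
  have hpos : ν (Metric.closedBall (0 : V) 1) ≠ 0 :=
    (Metric.measure_closedBall_pos ν 0 one_pos).ne'
  have hfin : ν (Metric.closedBall (0 : V) 1) ≠ ⊤ := measure_closedBall_lt_top.ne
  have h2 : (1 : ℝ≥0∞) ≤ (S.card : ℝ≥0∞) * ENNReal.ofReal (δ ^ finrank ℝ V) := by
    have h3 := h1
    nth_rewrite 1 [← one_mul (ν (Metric.closedBall (0 : V) 1))] at h3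
    exact (ENNReal.mul_le_mul_iff_left hpos hfin).1 h3
  rw [← ENNReal.ofReal_natCast, ← ENNReal.ofReal_mul (by positivity), ← ENNReal.ofReal_one] at h2
  exact (ENNReal.ofReal_le_ofReal_iff (by positivity)).1 h2

/-- A subspace `L` whose dimension is at most a sixth of that of `Z` is far from some point of the
unit ball of `Z`: otherwise a slightly larger ball of `L` would have room for the approximants of a
maximal `3 / 4`-separated subset of the unit ball of `Z`, which is too large by comparison of
volumes. -/
theorem exists_far_of_six_mul_finrank_le_real {V : Type*} [NormedAddCommGroup V] [NormedSpace ℝ V]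
    (Z L : Submodule ℝ V) [FiniteDimensional ℝ Z] [FiniteDimensional ℝ L]
    (hL : 0 < finrank ℝ L) (hdim : 6 * finrank ℝ L ≤ finrank ℝ Z) :
    ∃ z ∈ Z, ‖z‖ ≤ 1 ∧ ∀ x ∈ L, 1 / 10 ≤ ‖x - z‖ := by
  by_contra! hcon
  have key : ∀ S : Finset Z, (∀ c ∈ S, ‖c‖ ≤ 1) →
      (∀ c ∈ S, ∀ d ∈ S, c ≠ d → 3 / 4 ≤ ‖c - d‖) → S.card ≤ 5 ^ finrank ℝ L := by
    intro S hS hsep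
    have hchoice : ∀ c : Z, ∃ l : L, ‖(c : V)‖ ≤ 1 → ‖(l : V) - c‖ < 1 / 10 := by
      intro c
      by_cases hc : ‖(c : V)‖ ≤ 1
      · obtain ⟨x, hx, hxc⟩ := hcon c c.2 hc
        exact ⟨⟨x, hx⟩, fun _ => hxc⟩
      · exact ⟨0, fun h => absurd h hc⟩
    choose l hl using hchoice
    have hdist : ∀ c ∈ S, ∀ d ∈ S, c ≠ d → 11 / 20 ≤ ‖l c - l d‖ := by
      intro c hc d hd hcd
      have h1 := hl c (hS c hc)
      have h2 := hl d (hS d hd)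
      have h3 : (3 / 4 : ℝ) ≤ ‖(c : V) - d‖ := hsep c hc d hd hcd
      have h4 : ‖(c : V) - d‖ ≤ ‖(l c : V) - c‖ + ‖(l c : V) - l d‖ + ‖(l d : V) - d‖ := by
        have : (c : V) - d = -((l c : V) - c) + ((l c : V) - l d) + ((l d : V) - d) := by abel
        rw [this]
        refine (norm_add₃_le).trans ?_
        rw [norm_neg]
      have h5 : ‖l c - l d‖ = ‖(l c : V) - l d‖ := rfl
      rw [h5]; linarith
    -- Scaling by `20 / 11` makes the points `1`-separated and keeps them in the ball of radius `2`.
    have hinj : Set.InjOn (fun c => (20 / 11 : ℝ) • l c) (S : Set Z) := by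
      intro c hc d hd hcd
      by_contra hne
      have h1 := hdist c hc d hd hne
      have h2 : l c = l d := smul_right_injective L (by norm_num : (20 / 11 : ℝ) ≠ 0) hcd
      rw [h2, sub_self, norm_zero] at h1
      norm_num at h1
    classical
    rw [← Finset.card_image_of_injOn hinj]
    refine Besicovitch.card_le_of_separated _ ?_ ?_
    · intro x hx
      obtain ⟨c, hc, rfl⟩ := Finset.mem_image.1 hx
      have h1 := hl c (hS c hc)
      have h2 : ‖(l c : V)‖ ≤ ‖(l c : V) - c‖ + ‖(c : V)‖ := by
        simpa using norm_add_le ((l c : V) - c) (c : V)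
      have h3 : ‖(c : V)‖ ≤ 1 := hS c hc
      have h4 : ‖l c‖ = ‖(l c : V)‖ := rfl
      rw [norm_smul, h4, Real.norm_of_nonneg (by norm_num)]
      linarith
    · intro x hx y hy hxy
      obtain ⟨c, hc, rfl⟩ := Finset.mem_image.1 hx
      obtain ⟨d, hd, rfl⟩ := Finset.mem_image.1 hy
      have hcd : c ≠ d := fun h => hxy (by rw [h])
      have h1 := hdist c hc d hd hcd
      rw [← smul_sub, norm_smul, Real.norm_of_nonneg (by norm_num)]
      linarith
  -- A separated set of maximal cardinality is a `3/4`-net.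
  obtain ⟨S, ⟨hS, hsep⟩, hmax⟩ : ∃ S : Finset Z, ((∀ c ∈ S, ‖c‖ ≤ 1) ∧
      ∀ c ∈ S, ∀ d ∈ S, c ≠ d → 3 / 4 ≤ ‖c - d‖) ∧ ∀ S' : Finset Z, ((∀ c ∈ S', ‖c‖ ≤ 1) ∧
      ∀ c ∈ S', ∀ d ∈ S', c ≠ d → 3 / 4 ≤ ‖c - d‖) → S'.card ≤ S.card := by
    let P : ℕ → Prop := fun m => ∃ S : Finset Z, ((∀ c ∈ S, ‖c‖ ≤ 1) ∧
      ∀ c ∈ S, ∀ d ∈ S, c ≠ d → 3 / 4 ≤ ‖c - d‖) ∧ S.card = m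
    classical
    have hP0 : P 0 := ⟨∅, by simp, rfl⟩
    obtain ⟨S, hS, hc⟩ := Nat.findGreatest_spec (P := P) (Nat.zero_le (5 ^ finrank ℝ L)) hP0
    refine ⟨S, hS, fun S' hS' => ?_⟩
    rw [hc]
    exact Nat.le_findGreatest (key S' hS'.1 hS'.2) ⟨S', hS', rfl⟩
  have hnet : ∀ x : Z, ‖x‖ ≤ 1 → ∃ y ∈ S, ‖x - y‖ ≤ 3 / 4 := by
    intro x hx
    by_contra! hfar
    classical
    have hxS : x ∉ S := fun h => by
      have := hfar x h
      rw [sub_self, norm_zero] at this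
      norm_num at this
    have := hmax (insert x S) ⟨?_, ?_⟩
    · rw [Finset.card_insert_of_notMem hxS] at this
      omega
    · intro c hc
      rcases Finset.mem_insert.1 hc with rfl | hc
      exacts [hx, hS c hc]
    · intro c hc d hd hcd
      rcases Finset.mem_insert.1 hc with hcx | hcS <;>
        rcases Finset.mem_insert.1 hd with hdx | hdS
      · exact absurd (hcx.trans hdx.symm) hcd
      · rw [hcx]; exact (hfar d hdS).le
      · rw [hdx, norm_sub_rev]; exact (hfar c hcS).le
      · exact hsep c hcS d hdS hcd
  have h1 := one_le_card_mul_pow_of_ball_subset S (by norm_num : (0 : ℝ) ≤ 3 / 4) hnet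
  have h2 : (S.card : ℝ) ≤ 5 ^ finrank ℝ L := by exact_mod_cast key S hS hsep
  have h3 : (3 / 4 : ℝ) ^ finrank ℝ Z ≤ ((3 / 4 : ℝ) ^ 6) ^ finrank ℝ L := by
    rw [← pow_mul]
    exact pow_le_pow_of_le_one (by norm_num) (by norm_num) hdim
  have h4 : (S.card : ℝ) * (3 / 4) ^ finrank ℝ Z ≤ (5 * (3 / 4) ^ 6) ^ finrank ℝ L := by
    rw [mul_pow]; gcongr
  have h5 : (5 * (3 / 4 : ℝ) ^ 6) ^ finrank ℝ L < 1 :=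
    pow_lt_one₀ (by norm_num) (by norm_num) hL.ne'
  linarith

theorem exists_far_of_six_mul_finrank_le (Z L : Submodule 𝕜 E) [FiniteDimensional 𝕜 Z]
    [FiniteDimensional 𝕜 L] (hL : 0 < finrank 𝕜 L) (hdim : 6 * finrank 𝕜 L ≤ finrank 𝕜 Z) :
    ∃ z ∈ Z, ‖z‖ ≤ 1 ∧ ∀ x ∈ L, 1 / 10 ≤ ‖x - z‖ := by
  let : NormedSpace ℝ E := NormedSpace.restrictScalars ℝ 𝕜 E
  have : IsScalarTower ℝ 𝕜 E := inferInstance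
  have hd : ∀ M : Submodule 𝕜 E, finrank ℝ (M.restrictScalars ℝ) = finrank ℝ 𝕜 * finrank 𝕜 M :=
    fun M => (finrank_mul_finrank ℝ 𝕜 M).symm
  have hpos : 0 < finrank ℝ 𝕜 := finrank_pos
  have : FiniteDimensional ℝ (Z.restrictScalars ℝ) := FiniteDimensional.trans ℝ 𝕜 Z
  have : FiniteDimensional ℝ (L.restrictScalars ℝ) := FiniteDimensional.trans ℝ 𝕜 L
  exact exists_far_of_six_mul_finrank_le_real (Z.restrictScalars ℝ) (L.restrictScalars ℝ)
    (by rw [hd]; positivity) (by rw [hd, hd]; nlinarith)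

theorem le_kolmogorovWidth {n : ℕ} (hn : 1 ≤ n) {Y : Set E} {c : ℝ} (hc : 0 ≤ c)
    (Z : Submodule 𝕜 E) [FiniteDimensional 𝕜 Z] (hZ : 6 * n ≤ finrank 𝕜 Z)
    (hY : ∀ z ∈ Z, ‖z‖ ≤ c → z ∈ Y) :
    ENNReal.ofReal (c / 10) ≤ kolmogorovWidth 𝕜 n Y := by
  refine le_iInf₂ fun L hL => ?_
  have : FiniteDimensional 𝕜 L := Module.rank_lt_aleph0_iff.1
    (hL ▸ Cardinal.natCast_lt_aleph0)
  have hfin : finrank 𝕜 L = n := finrank_eq_of_rank_eq hL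
  obtain ⟨z, hz, hz1, hfar⟩ := exists_far_of_six_mul_finrank_le Z L (by omega) (by omega)
  have hcn : ‖(c : 𝕜)‖ = c := by rw [RCLike.norm_ofReal, abs_of_nonneg hc]
  refine le_trans ?_ (le_iSup₂ (f := fun y (_ : y ∈ Y) => ⨅ x ∈ L, ‖x - y‖ₑ) ((c : 𝕜) • z)
    (hY _ (Z.smul_mem _ hz) ?_))
  · refine le_iInf₂ fun x hx => ?_
    rw [← ofReal_norm]
    refine ENNReal.ofReal_le_ofReal ?_
    rcases hc.eq_or_lt with rfl | hc0
    · simp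
    · have hne : (c : 𝕜) ≠ 0 := by simpa using hc0.ne'
      have h1 := hfar ((c : 𝕜)⁻¹ • x) (L.smul_mem _ hx)
      have h2 : x - (c : 𝕜) • z = (c : 𝕜) • ((c : 𝕜)⁻¹ • x - z) := by
        rw [smul_sub, smul_inv_smul₀ hne]
      rw [h2, norm_smul, hcn]
      calc c / 10 = c * (1 / 10) := by ring
        _ ≤ _ := by gcongr
  · rw [norm_smul, hcn]
    exact mul_le_of_le_one_right hc hz1

/-- A subspace of codimension at most `n` meets every `(n + 1)`-dimensional subspace. -/
theorem exists_norm_one_mem_inf_of_rank_lt (Z M : Submodule 𝕜 E)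
    (h : Module.rank 𝕜 (E ⧸ M) < Module.rank 𝕜 Z) : ∃ z ∈ Z, z ∈ M ∧ ‖z‖ = 1 := by
  obtain ⟨z, hz0, hz⟩ : ∃ z : Z, z ≠ 0 ∧ M.mkQ.comp Z.subtype z = 0 := by
    by_contra! hcon
    have hinj : Function.Injective (M.mkQ.comp Z.subtype) := by
      rw [← LinearMap.ker_eq_bot, LinearMap.ker_eq_bot']
      intro z hz
      by_contra hne
      exact hcon z hne hz
    have h1 := LinearMap.lift_rank_le_of_injective _ hinj
    rw [Cardinal.lift_id, Cardinal.lift_id] at h1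
    exact absurd h1 (not_le.2 h)
  have hzM : (z : E) ∈ M := by simpa using hz
  have hne : (z : E) ≠ 0 := by simpa using hz0
  refine ⟨((‖(z : E)‖⁻¹ : ℝ) : 𝕜) • (z : E), Z.smul_mem _ z.2, M.smul_mem _ hzM, ?_⟩
  rw [norm_smul, RCLike.norm_ofReal, abs_of_nonneg (by positivity)]
  exact inv_mul_cancel₀ (norm_ne_zero_iff.2 hne)

theorem bernsteinWidth_le_gelfandWidth (n : ℕ) (Y : Set E) :
    bernsteinWidth 𝕜 n Y ≤ gelfandWidth 𝕜 n Y := by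
  refine iSup₂_le fun Z hZ => iSup₂_le fun c hc => le_iInf fun M => le_iInf₂ fun _ hM => ?_
  have hlt : Module.rank 𝕜 (E ⧸ M) < Module.rank 𝕜 Z :=
    (hM.trans_lt (by exact_mod_cast Nat.lt_succ_self n)).trans_le hZ
  obtain ⟨z, hzZ, hzM, hz1⟩ := exists_norm_one_mem_inf_of_rank_lt Z M hlt
  refine le_trans ?_ (le_iSup₂ (f := fun x (_ : x ∈ Y ∩ (M : Set E)) => ‖x‖ₑ)
    (((c : ℝ) : 𝕜) • z) ⟨hc z hzZ hz1.le, M.smul_mem _ hzM⟩)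
  rw [← ofReal_norm, norm_smul, hz1, mul_one, RCLike.norm_ofReal,
    abs_of_nonneg (NNReal.coe_nonneg c), ENNReal.ofReal_coe_nnreal]

theorem gelfandWidth_le_linearWidth (n : ℕ) (Y : Set E) :
    gelfandWidth 𝕜 n Y ≤ linearWidth 𝕜 n Y := by
  refine le_iInf₂ fun F hF => ?_
  have hrank : Module.rank 𝕜 (E ⧸ LinearMap.ker (F : E →ₗ[𝕜] E)) ≤ n := by
    rw [(F : E →ₗ[𝕜] E).quotKerEquivRange.rank_eq]
    exact hF
  refine (iInf_le_of_le (LinearMap.ker (F : E →ₗ[𝕜] E)) (iInf₂_le F.isClosed_ker hrank)).trans ?_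
  refine iSup₂_le fun x hx => ?_
  refine le_trans (le_of_eq ?_) (le_iSup₂ (f := fun x (_ : x ∈ Y) => ‖x - F x‖ₑ) x hx.1)
  have : F x = 0 := hx.2
  simp [this]

theorem exists_submodule_rank_eq_of_le (hE : ∀ n : ℕ, (n : Cardinal) ≤ Module.rank 𝕜 E) (n : ℕ)
    (R : Submodule 𝕜 E) (hR : Module.rank 𝕜 R ≤ n) :
    ∃ L : Submodule 𝕜 E, R ≤ L ∧ Module.rank 𝕜 L = n := by
  have : FiniteDimensional 𝕜 R := Module.rank_lt_aleph0_iff.1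
    (hR.trans_lt Cardinal.natCast_lt_aleph0)
  have hRf : finrank 𝕜 R ≤ n := by
    rw [← finrank_eq_rank] at hR
    exact_mod_cast hR
  have key : ∀ m : ℕ, ∃ L : Submodule 𝕜 E, R ≤ L ∧
      Module.rank 𝕜 L = ((finrank 𝕜 R + m : ℕ) : Cardinal) := by
    intro m
    induction m with
    | zero => exact ⟨R, le_rfl, by simp⟩
    | succ m ih =>
      obtain ⟨L, hRL, hL⟩ := ih
      have hLtop : L ≠ ⊤ := by
        rintro rfl
        have h1 := hE (finrank 𝕜 R + m + 1)
        rw [← rank_top, hL] at h1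
        have : finrank 𝕜 R + m + 1 ≤ finrank 𝕜 R + m := by exact_mod_cast h1
        omega
      obtain ⟨v, hv⟩ : ∃ v, v ∉ L := by
        by_contra! h
        exact hLtop ((Submodule.eq_top_iff').2 h)
      have : FiniteDimensional 𝕜 L := Module.rank_lt_aleph0_iff.1
        (hL ▸ Cardinal.natCast_lt_aleph0)
      have hv0 : v ≠ 0 := fun h => hv (h ▸ L.zero_mem)
      refine ⟨L ⊔ Submodule.span 𝕜 {v}, hRL.trans le_sup_left, ?_⟩
      have hfL : finrank 𝕜 L = finrank 𝕜 R + m := finrank_eq_of_rank_eq hL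
      have hinf : L ⊓ Submodule.span 𝕜 {v} = ⊥ :=
        disjoint_iff.1 ((Submodule.disjoint_span_singleton' hv0).2 hv)
      have := Submodule.finrank_sup_add_finrank_inf_eq L (Submodule.span 𝕜 {v})
      rw [hinf, finrank_bot, finrank_span_singleton hv0, hfL] at this
      rw [← finrank_eq_rank]
      exact_mod_cast this
  obtain ⟨L, hRL, hL⟩ := key (n - finrank 𝕜 R)
  exact ⟨L, hRL, by rw [hL, Nat.add_sub_cancel' hRf]⟩

theorem kolmogorovWidth_le_linearWidth (hE : ∀ n : ℕ, (n : Cardinal) ≤ Module.rank 𝕜 E) (n : ℕ)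
    (Y : Set E) : kolmogorovWidth 𝕜 n Y ≤ linearWidth 𝕜 n Y := by
  refine le_iInf₂ fun F hF => ?_
  obtain ⟨L, hFL, hL⟩ := exists_submodule_rank_eq_of_le hE n _ hF
  refine (iInf₂_le L hL).trans (iSup₂_mono fun y _ => ?_)
  refine (iInf₂_le (F y) (hFL ⟨y, rfl⟩)).trans (le_of_eq ?_)
  rw [← ofReal_norm, ← ofReal_norm, norm_sub_rev]

theorem le_bernsteinWidth {n : ℕ} {Y : Set E} {c : ℝ} (hc : 0 ≤ c) (Z : Submodule 𝕜 E)
    [FiniteDimensional 𝕜 Z] (hZ : n + 1 ≤ finrank 𝕜 Z) (hY : ∀ z ∈ Z, ‖z‖ ≤ c → z ∈ Y) :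
    ENNReal.ofReal c ≤ bernsteinWidth 𝕜 n Y := by
  have hZ' : ((n + 1 : ℕ) : Cardinal) ≤ Module.rank 𝕜 Z := by
    rw [← finrank_eq_rank]
    exact_mod_cast hZ
  refine le_trans ?_ (le_iSup₂ (f := fun (L : Submodule 𝕜 E)
    (_ : ((n + 1 : ℕ) : Cardinal) ≤ Module.rank 𝕜 L) =>
    ⨆ (c : ℝ≥0) (_ : ∀ x ∈ L, ‖x‖ ≤ 1 → ((c : ℝ) : 𝕜) • x ∈ Y), (c : ℝ≥0∞)) Z hZ')
  refine le_iSup₂ (f := fun (c : ℝ≥0) (_ : ∀ x ∈ Z, ‖x‖ ≤ 1 → ((c : ℝ) : 𝕜) • x ∈ Y) =>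
    (c : ℝ≥0∞)) c.toNNReal fun x hx hx1 => hY _ (Z.smul_mem _ hx) ?_
  rw [norm_smul, RCLike.norm_ofReal, abs_of_nonneg (NNReal.coe_nonneg _), Real.coe_toNNReal c hc]
  exact mul_le_of_le_one_right hc hx1

end WidthComparison

/-! ### Chebyshev expansion of a smooth cutoff -/

section Chebyshev

open Polynomial Polynomial.Chebyshev

theorem sum_abs_coeff_X_mul_le (P : ℝ[X]) (N : ℕ) :
    ∑ j ∈ Finset.range N, |(X * P).coeff j| ≤ ∑ j ∈ Finset.range N, |P.coeff j| := by
  cases N with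
  | zero => simp
  | succ N =>
    rw [Finset.sum_range_succ', coeff_X_mul_zero, abs_zero, add_zero]
    simp only [coeff_X_mul]
    exact Finset.sum_le_sum_of_subset_of_nonneg
      (Finset.range_subset_range.2 (Nat.le_succ N)) fun _ _ _ => abs_nonneg _

theorem sum_abs_coeff_T_natCast_le (N n : ℕ) :
    ∑ j ∈ Finset.range N, |(T ℝ (n : ℤ)).coeff j| ≤ 3 ^ n := by
  induction n using Nat.twoStepInduction with
  | zero =>
    simp only [Nat.cast_zero, T_zero, coeff_one, pow_zero]
    refine (Finset.sum_le_sum (g := fun j => if j = 0 then (1 : ℝ) else 0) fun j _ => ?_).trans ?_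
    · split_ifs <;> simp
    · rw [Finset.sum_ite_eq']; split_ifs <;> norm_num
  | one =>
    simp only [Nat.cast_one, T_one, pow_one]
    refine (Finset.sum_le_sum (g := fun j => if j = 1 then (1 : ℝ) else 0) fun j _ => ?_).trans ?_
    · rcases eq_or_ne j 1 with rfl | hj
      · simp
      · rw [coeff_X_of_ne_one hj, if_neg hj, abs_zero]
    · rw [Finset.sum_ite_eq']; split_ifs <;> norm_num
  | more n ih1 ih2 =>
    have hrec : T ℝ ((n + 2 : ℕ) : ℤ) = 2 * (X * T ℝ ((n + 1 : ℕ) : ℤ)) - T ℝ (n : ℤ) := by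
      push_cast
      rw [T_add_two]; ring
    have h1 : ∀ j, |(T ℝ ((n + 2 : ℕ) : ℤ)).coeff j| ≤
        2 * |(X * T ℝ ((n + 1 : ℕ) : ℤ)).coeff j| + |(T ℝ (n : ℤ)).coeff j| := by
      intro j
      rw [hrec, coeff_sub, show (2 : ℝ[X]) = C 2 from rfl, coeff_C_mul]
      refine (abs_sub _ _).trans ?_
      rw [abs_mul, abs_two]
    calc _ ≤ ∑ j ∈ Finset.range N, (2 * |(X * T ℝ ((n + 1 : ℕ) : ℤ)).coeff j| +
          |(T ℝ (n : ℤ)).coeff j|) := Finset.sum_le_sum fun j _ => h1 j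
      _ ≤ 2 * 3 ^ (n + 1) + 3 ^ n := by
        rw [Finset.sum_add_distrib, ← Finset.mul_sum]
        gcongr
        exact (sum_abs_coeff_X_mul_le _ _).trans ih2
      _ ≤ 3 ^ (n + 2) := by
        have : (0 : ℝ) < 3 ^ n := by positivity
        rw [pow_succ, pow_add]; linarith

theorem sum_abs_coeff_T_le (N : ℕ) (n : ℤ) :
    ∑ j ∈ Finset.range N, |(T ℝ n).coeff j| ≤ 3 ^ n.natAbs := by
  rw [← T_natAbs]
  exact sum_abs_coeff_T_natCast_le N n.natAbs

theorem natDegree_T_le (n : ℤ) : (T ℝ n).natDegree ≤ n.natAbs := by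
  simp

end Chebyshev

section Fourier

open Real

/-- Repeated integration by parts: Fourier coefficients of smooth periodic functions decrease
rapidly. -/
theorem exists_fourierCoeffOn_norm_mul_pow_le {P : ℝ} (hP : 0 < P) (K : ℕ) :
    ∀ f : ℝ → ℂ, ContDiff ℝ (⊤ : ℕ∞) f → Function.Periodic f P →
      ∃ C : ℝ, ∀ n : ℤ, ‖fourierCoeffOn hP f n‖ * |(n : ℝ)| ^ K ≤ C := by
  induction K with
  | zero =>
    intro f hf _
    obtain ⟨M, hM⟩ := (isCompact_Icc (a := (0 : ℝ)) (b := P)).exists_bound_of_continuousOn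
      hf.continuous.continuousOn
    refine ⟨(1 / P) * (M * P), fun n => ?_⟩
    rw [pow_zero, mul_one, fourierCoeffOn_eq_integral, norm_smul, sub_zero, norm_of_nonneg
      (by positivity)]
    gcongr
    refine (intervalIntegral.norm_integral_le_of_norm_le_const (C := M) fun x hx => ?_).trans ?_
    · rw [norm_smul, fourier_apply, Circle.norm_coe, one_mul]
      rw [Set.uIoc_of_le hP.le] at hx
      exact hM x (Set.Ioc_subset_Icc_self hx)
    · rw [sub_zero, abs_of_pos hP]
  | succ K ih =>
    intro f hf hper
    have hdiff : Differentiable ℝ f := hf.differentiable (by simp)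
    have hf' : ContDiff ℝ (⊤ : ℕ∞) (deriv f) :=
      (contDiff_infty_iff_deriv.1 hf).2
    have hper' : Function.Periodic (deriv f) P := by
      intro x
      rw [← deriv_comp_add_const]
      congr 1
      ext y
      exact hper y
    obtain ⟨C, hC⟩ := ih (deriv f) hf' hper'
    refine ⟨max 0 (P / (2 * π) * C), fun n => ?_⟩
    rcases eq_or_ne n 0 with rfl | hn
    · simp
    refine le_trans ?_ (le_max_right _ _)
    have h0 : f P = f 0 := by simpa using hper 0
    have hrel := fourierCoeffOn_of_hasDerivAt hP hn (f := f) (f' := deriv f)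
      (fun x _ => (hdiff x).hasDerivAt) (hf'.continuous.intervalIntegrable _ _)
    rw [h0, sub_self, mul_zero, zero_sub, Complex.ofReal_zero, sub_zero] at hrel
    have hn' : (0 : ℝ) < |(n : ℝ)| := abs_pos.2 (by exact_mod_cast hn)
    have hnorm : ‖fourierCoeffOn hP f n‖ = P / (2 * π) * ‖fourierCoeffOn hP (deriv f) n‖ /
        |(n : ℝ)| := by
      rw [hrel, norm_mul, norm_neg, norm_mul, norm_div, norm_mul, norm_mul, norm_mul, norm_neg]
      simp only [norm_one, Complex.norm_I, Complex.norm_real, Complex.norm_intCast, norm_eq_abs,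
        abs_of_pos hP, abs_of_pos pi_pos, Complex.norm_ofNat]
      field_simp
    calc ‖fourierCoeffOn hP f n‖ * |(n : ℝ)| ^ (K + 1)
        = P / (2 * π) * (‖fourierCoeffOn hP (deriv f) n‖ * |(n : ℝ)| ^ K) := by
          rw [hnorm, pow_succ]; field_simp
      _ ≤ P / (2 * π) * C := by gcongr; exact hC n

theorem exists_summable_cos_series {f : ℝ → ℝ} (hf : ContDiff ℝ (⊤ : ℕ∞) f)
    (hper : Function.Periodic f (2 * π)) (heven : Function.Even f) (K : ℕ) :
    ∃ a : ℤ → ℝ, Summable (fun n => |a n| * (n.natAbs + 1 : ℝ) ^ K) ∧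
      ∀ θ, HasSum (fun n : ℤ => a n * cos (n * θ)) (f θ) := by
  let g : ℝ → ℂ := fun x => (f x : ℂ)
  have hg : ContDiff ℝ (⊤ : ℕ∞) g := Complex.ofRealCLM.contDiff.comp hf
  have hgper : Function.Periodic g (2 * π) := fun x => by simp only [g, hper x]
  have : Fact (0 < 2 * π) := ⟨two_pi_pos⟩
  let G : C(AddCircle (2 * π), ℂ) := ⟨hgper.lift, continuous_coinduced_dom.2 hg.continuous⟩
  have hG : ∀ x : ℝ, G (x : AddCircle (2 * π)) = f x := fun x => rfl
  have hcoeff : ∀ n, fourierCoeff G n = fourierCoeffOn two_pi_pos g n := by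
    intro n
    rw [fourierCoeffOn_eq_integral, fourierCoeff_eq_intervalIntegral _ _ 0, sub_zero, zero_add]
    congr 1
  obtain ⟨C, hC⟩ := exists_fourierCoeffOn_norm_mul_pow_le two_pi_pos (K + 2) g hg hgper
  have hsumK : Summable (fun n : ℤ => ‖fourierCoeff G n‖ * (n.natAbs + 1 : ℝ) ^ K) := by
    have hz : Summable (fun n : ℤ => 1 / |(n : ℝ)| ^ 2) := by
      simpa using Real.summable_one_div_int_pow.2 one_lt_two
    refine Summable.of_norm_bounded_eventually (hz.mul_left (2 ^ K * C)) ?_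
    have hfin : ({0} : Set ℤ).Finite := Set.finite_singleton 0
    filter_upwards [hfin.compl_mem_cofinite] with n hn
    have hn0 : n ≠ 0 := hn
    have h1 : (1 : ℝ) ≤ |(n : ℝ)| := by exact_mod_cast Int.one_le_abs hn0
    have h2 : ((n.natAbs : ℕ) : ℝ) = |(n : ℝ)| := by rw [Nat.cast_natAbs]; simp
    rw [norm_of_nonneg (by positivity), h2, hcoeff]
    calc ‖fourierCoeffOn two_pi_pos g n‖ * (|(n : ℝ)| + 1) ^ K
        ≤ ‖fourierCoeffOn two_pi_pos g n‖ * (2 * |(n : ℝ)|) ^ K := by gcongr; linarith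
      _ = 2 ^ K * (‖fourierCoeffOn two_pi_pos g n‖ * |(n : ℝ)| ^ (K + 2)) *
          (1 / |(n : ℝ)| ^ 2) := by
        have : |(n : ℝ)| ≠ 0 := by positivity
        rw [mul_pow, pow_add]; field_simp
      _ ≤ 2 ^ K * C * (1 / |(n : ℝ)| ^ 2) := by gcongr; exact hC n
  have hsum : Summable (fourierCoeff G) := by
    refine Summable.of_norm (hsumK.of_nonneg_of_le (fun _ => norm_nonneg _) fun n => ?_)
    exact le_mul_of_one_le_right (norm_nonneg _)
      (one_le_pow₀ (by linarith [n.natAbs.cast_nonneg (α := ℝ)]))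
  refine ⟨fun n => (fourierCoeff G n).re,
    hsumK.of_nonneg_of_le (fun n => by positivity) fun n => ?_, fun θ => ?_⟩
  · gcongr
    exact Complex.abs_re_le_norm _
  -- Averaging the Fourier series at `θ` and at `-θ` leaves the cosines.
  have h1 : ∀ x : ℝ, HasSum (fun n : ℤ => (fourierCoeff G n *
      Complex.exp (n * x * Complex.I)).re) (f x) := by
    intro x
    have := Complex.hasSum_re
      (has_pointwise_sum_fourier_series_of_summable hsum (x : AddCircle (2 * π)))
    rw [hG, Complex.ofReal_re] at this
    refine this.congr_fun fun n => ?_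
    rw [smul_eq_mul, fourier_coe_apply]
    congr 3
    have : (π : ℂ) ≠ 0 := by exact_mod_cast pi_ne_zero
    push_cast
    field_simp
  have h2 := ((h1 θ).add (h1 (-θ))).mul_left (1 / 2 : ℝ)
  rw [heven θ] at h2
  have h3 : 1 / 2 * (f θ + f θ) = f θ := by ring
  rw [h3] at h2
  refine h2.congr_fun fun n => ?_
  · have e1 : (n : ℂ) * (θ : ℂ) * Complex.I = ((n * θ : ℝ) : ℂ) * Complex.I := by push_cast; ring
    have e2 : (n : ℂ) * ((-θ : ℝ) : ℂ) * Complex.I = ((-(n * θ) : ℝ) : ℂ) * Complex.I := by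
      push_cast; ring
    rw [e1, e2, Complex.mul_re, Complex.mul_re, Complex.exp_ofReal_mul_I_re,
      Complex.exp_ofReal_mul_I_re, Complex.exp_ofReal_mul_I_im, Complex.exp_ofReal_mul_I_im,
      cos_neg, sin_neg]
    ring

/-- A smooth cutoff, divided by the identity: it vanishes on `(-∞, b / 2]` and equals `1 / u` for
`b ≤ u`. -/
noncomputable def cutoffDiv (b u : ℝ) : ℝ := smoothTransition ((u - b / 2) / (b / 2)) / u

theorem cutoffDiv_of_le {b u : ℝ} (hb : 0 < b) (hu : u ≤ b / 2) : cutoffDiv b u = 0 := by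
  rw [cutoffDiv, smoothTransition.zero_of_nonpos, zero_div]
  exact div_nonpos_of_nonpos_of_nonneg (by linarith) (by linarith)

theorem mul_cutoffDiv_of_le {b u : ℝ} (hb : 0 < b) (hu : b ≤ u) : u * cutoffDiv b u = 1 := by
  have hu0 : u ≠ 0 := (hb.trans_le hu).ne'
  rw [cutoffDiv, smoothTransition.one_of_one_le, mul_one_div_cancel hu0]
  rw [le_div_iff₀ (by linarith)]; linarith

theorem contDiff_cutoffDiv {b : ℝ} (hb : 0 < b) : ContDiff ℝ (⊤ : ℕ∞) (cutoffDiv b) := by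
  rw [contDiff_iff_contDiffAt]
  intro u
  rcases lt_or_ge u (b / 2) with hu | hu
  · refine contDiffAt_const (c := (0 : ℝ)) |>.congr_of_eventuallyEq ?_
    filter_upwards [Iio_mem_nhds hu] with v hv
    exact cutoffDiv_of_le hb (le_of_lt hv)
  · have hu0 : u ≠ 0 := by linarith
    refine ContDiffAt.div ?_ contDiffAt_id hu0
    exact smoothTransition.contDiffAt.comp u
      ((contDiffAt_id.sub contDiffAt_const).div_const _)

/-- The cutoff has rapidly decreasing Chebyshev coefficients on `[-1, 1]`. The Chebyshev polynomials
are indexed by `ℤ`, where `T (-n) = T n`, in accordance with the Fourier series of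
`θ ↦ cutoffDiv b (cos θ)`. -/
theorem exists_chebyshev_cutoff {b : ℝ} (hb : 0 < b) (K : ℕ) :
    ∃ a : ℤ → ℝ, Summable (fun n => |a n| * (n.natAbs + 1 : ℝ) ^ K) ∧
      ∀ u : ℝ, |u| ≤ 1 → HasSum (fun n => a n * (Polynomial.Chebyshev.T ℝ n).eval u)
        (cutoffDiv b u) := by
  obtain ⟨a, ha, hsum⟩ := exists_summable_cos_series (f := fun θ => cutoffDiv b (cos θ))
    ((contDiff_cutoffDiv hb).comp contDiff_cos) (fun θ => by simp) (fun θ => by simp) K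
  refine ⟨a, ha, fun u hu => ?_⟩
  have h := hsum (arccos u)
  rw [abs_le] at hu
  simp_rw [← Polynomial.Chebyshev.T_real_cos, cos_arccos hu.1 hu.2] at h
  exact h

end Fourier

/-! ### Schur's test -/

section Schur

variable {𝕜 X : Type*} [RCLike 𝕜] [MeasurableSpace X] {μ : Measure X}

/-- Jensen's inequality for the measure with density `k`. -/
theorem rpow_lintegral_mul_le {k g : X → ℝ≥0∞} (hk : Measurable k) (hg : Measurable g) {A : ℝ≥0∞}
    (hA : ∫⁻ y, k y ∂μ ≤ A) {q : ℝ} (hq : 1 ≤ q) :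
    (∫⁻ y, k y * g y ∂μ) ^ q ≤ A ^ (q - 1) * ∫⁻ y, k y * g y ^ q ∂μ := by
  have hq0 : 0 < q := one_pos.trans_le hq
  let ν : Measure X := μ.withDensity k
  have hν : ∀ h : X → ℝ≥0∞, Measurable h → ∫⁻ y, h y ∂ν = ∫⁻ y, k y * h y ∂μ := fun h hh =>
    lintegral_withDensity_eq_lintegral_mul μ hk hh
  have huniv : ν Set.univ ≤ A := by
    rw [withDensity_apply _ MeasurableSet.univ, Measure.restrict_univ]
    exact hA
  rw [← hν g hg, ← hν _ (hg.pow_const q)]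
  have h := eLpNorm'_le_eLpNorm'_mul_rpow_measure_univ (μ := ν) (f := g) one_pos hq
    hg.aestronglyMeasurable
  simp only [eLpNorm', enorm_eq_self, ENNReal.rpow_one, div_one] at h
  calc (∫⁻ y, g y ∂ν) ^ q
      ≤ ((∫⁻ y, g y ^ q ∂ν) ^ (1 / q) * ν Set.univ ^ (1 - 1 / q)) ^ q := by gcongr
    _ = ν Set.univ ^ (q - 1) * ∫⁻ y, g y ^ q ∂ν := by
      rw [ENNReal.mul_rpow_of_nonneg _ _ hq0.le, ← ENNReal.rpow_mul, ← ENNReal.rpow_mul,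
        one_div_mul_cancel hq0.ne', ENNReal.rpow_one, mul_comm, sub_mul,
        one_div_mul_cancel hq0.ne', one_mul]
    _ ≤ _ := by
      gcongr

/-- Schur's test: a kernel with bounded `L₁` norms in each variable acts on every `Lₚ`. -/
theorem eLpNorm_integral_mul_le [SFinite μ] {K : X → X → 𝕜} (hK : Measurable (Function.uncurry K))
    {A : ℝ≥0∞} (hA₁ : ∀ x, ∫⁻ y, ‖K x y‖ₑ ∂μ ≤ A) (hA₂ : ∀ y, ∫⁻ x, ‖K x y‖ₑ ∂μ ≤ A)
    {f : X → 𝕜} (hf : Measurable f) {p : ℝ≥0∞} (hp : 1 ≤ p) :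
    eLpNorm (fun x => ∫ y, K x y * f y ∂μ) p μ ≤ A * eLpNorm f p μ := by
  have hpt : ∀ x, ‖∫ y, K x y * f y ∂μ‖ₑ ≤ ∫⁻ y, ‖K x y‖ₑ * ‖f y‖ₑ ∂μ := fun x =>
    (enorm_integral_le_lintegral_enorm _).trans (le_of_eq (by simp_rw [enorm_mul]))
  have hKx : ∀ x, Measurable fun y => ‖K x y‖ₑ := fun x =>
    (hK.comp measurable_prodMk_left).enorm
  have hKy : ∀ y, Measurable fun x => ‖K x y‖ₑ := fun y =>
    (hK.comp measurable_prodMk_right).enorm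
  rcases eq_or_ne p ⊤ with rfl | hptop
  · rw [eLpNorm_exponent_top, eLpNorm_exponent_top]
    refine eLpNormEssSup_le_of_ae_enorm_bound (ae_of_all _ fun x => (hpt x).trans ?_)
    calc ∫⁻ y, ‖K x y‖ₑ * ‖f y‖ₑ ∂μ ≤ ∫⁻ y, ‖K x y‖ₑ * eLpNormEssSup f μ ∂μ := by
          refine lintegral_mono_ae ?_
          filter_upwards [enorm_ae_le_eLpNormEssSup f μ] with y hy
          gcongr
      _ ≤ _ := by
        rw [lintegral_mul_const _ (hKx x)]
        gcongr
        exact hA₁ x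
  · have hp0 : p ≠ 0 := (one_pos.trans_le hp).ne'
    have hq : 1 ≤ p.toReal := by
      rw [← ENNReal.toReal_one]
      exact ENNReal.toReal_mono hptop hp
    rw [eLpNorm_eq_lintegral_rpow_enorm_toReal hp0 hptop,
      eLpNorm_eq_lintegral_rpow_enorm_toReal hp0 hptop]
    set q := p.toReal with hqdef
    have hq0 : 0 < q := one_pos.trans_le hq
    have hmain : ∫⁻ x, ‖∫ y, K x y * f y ∂μ‖ₑ ^ q ∂μ ≤ A ^ q * ∫⁻ y, ‖f y‖ₑ ^ q ∂μ := by
      have hfq : Measurable fun y => ‖f y‖ₑ ^ q := hf.enorm.pow_const q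
      have hKm : Measurable (Function.uncurry fun x y => ‖K x y‖ₑ * ‖f y‖ₑ ^ q) :=
        hK.enorm.mul (hfq.comp measurable_snd)
      calc ∫⁻ x, ‖∫ y, K x y * f y ∂μ‖ₑ ^ q ∂μ
          ≤ ∫⁻ x, A ^ (q - 1) * ∫⁻ y, ‖K x y‖ₑ * ‖f y‖ₑ ^ q ∂μ ∂μ := by
            refine lintegral_mono fun x => ?_
            exact (ENNReal.rpow_le_rpow (hpt x) hq0.le).trans
              (rpow_lintegral_mul_le (hKx x) hf.enorm (hA₁ x) hq)
        _ = A ^ (q - 1) * ∫⁻ y, ∫⁻ x, ‖K x y‖ₑ * ‖f y‖ₑ ^ q ∂μ ∂μ := by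
            have hKi : Measurable fun x => ∫⁻ y, ‖K x y‖ₑ * ‖f y‖ₑ ^ q ∂μ :=
              hKm.lintegral_prod_right'
            rw [lintegral_const_mul _ hKi, lintegral_lintegral_swap hKm.aemeasurable]
        _ ≤ A ^ (q - 1) * ∫⁻ y, A * ‖f y‖ₑ ^ q ∂μ := by
            gcongr with y
            rw [lintegral_mul_const _ (hKy y)]
            gcongr
            exact hA₂ y
        _ = A ^ q * ∫⁻ y, ‖f y‖ₑ ^ q ∂μ := by
            rw [lintegral_const_mul _ hfq, ← mul_assoc]
            congr 1
            nth_rewrite 2 [← ENNReal.rpow_one A]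
            rw [← ENNReal.rpow_add_of_nonneg _ _ (by linarith) zero_le_one, sub_add_cancel]
    calc _ ≤ (A ^ q * ∫⁻ y, ‖f y‖ₑ ^ q ∂μ) ^ (1 / q) := by gcongr
      _ = _ := by
        rw [ENNReal.mul_rpow_of_nonneg _ _ (by positivity), ← ENNReal.rpow_mul,
          mul_one_div_cancel hq0.ne', ENNReal.rpow_one]

theorem setLIntegral_le_mul_of_forall_mem_le {g : X → ℝ≥0∞} (hg : Measurable g) (S : Set X)
    {c : ℝ≥0∞} (h : ∀ y ∈ S, g y ≤ c) : ∫⁻ y in S, g y ∂μ ≤ c * μ S := by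
  rw [← setLIntegral_const]
  exact lintegral_mono_ae ((ae_restrict_iff (measurableSet_le hg measurable_const)).2
    (ae_of_all _ h))

end Schur

/-! ### Kernels of spectral multipliers -/

section SpectralKernel

variable {𝕜 X : Type*} [RCLike 𝕜]

/-- The kernel `∑ₖ wₖ φₖ(x) φₖ(y)*` of the spectral multiplier with eigenvalues `wₖ`. -/
noncomputable def spectralKernel (φ : ℕ → X → 𝕜) (w : ℕ → ℝ) (x y : X) : 𝕜 :=
  ∑' k, (w k : 𝕜) * φ k x * conj (φ k y)

/-- The eigenvalue `exp (-λₖ² t)` of the heat operator at time `t`. -/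
noncomputable def heatEigenvalue (lam : ℕ → ℝ) (t : ℝ) (k : ℕ) : ℝ := Real.exp (-(lam k) ^ 2 * t)

theorem heatEigenvalue_pos (lam : ℕ → ℝ) (t : ℝ) (k : ℕ) : 0 < heatEigenvalue lam t k :=
  Real.exp_pos _

theorem heatEigenvalue_le_one (lam : ℕ → ℝ) {t : ℝ} (ht : 0 ≤ t) (k : ℕ) :
    heatEigenvalue lam t k ≤ 1 :=
  Real.exp_le_one_iff.2 (by nlinarith [sq_nonneg (lam k)])

theorem heatEigenvalue_anti (lam : ℕ → ℝ) {s t : ℝ} (hst : s ≤ t) (k : ℕ) :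
    heatEigenvalue lam t k ≤ heatEigenvalue lam s k :=
  Real.exp_le_exp.2 (by nlinarith [sq_nonneg (lam k)])

theorem heatEigenvalue_pow (lam : ℕ → ℝ) (t : ℝ) (k j : ℕ) :
    heatEigenvalue lam t k ^ j = heatEigenvalue lam (j * t) k := by
  rw [heatEigenvalue, heatEigenvalue, ← Real.exp_nat_mul]
  congr 1; ring

theorem norm_spectralKernel_term (φ : ℕ → X → 𝕜) (w : ℕ → ℝ) (x y : X) (k : ℕ) :
    ‖(w k : 𝕜) * φ k x * conj (φ k y)‖ = |w k| * (‖φ k x‖ * ‖φ k y‖) := by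
  rw [norm_mul, norm_mul, RCLike.norm_ofReal, RCLike.norm_conj, mul_assoc]

theorem enorm_spectralKernel_symm (φ : ℕ → X → 𝕜) (w : ℕ → ℝ) (x y : X) :
    ‖spectralKernel φ w x y‖ₑ = ‖spectralKernel φ w y x‖ₑ := by
  have : spectralKernel φ w x y = conj (spectralKernel φ w y x) := by
    rw [spectralKernel, spectralKernel, RCLike.conj_tsum]
    refine tsum_congr fun k => ?_
    rw [map_mul, map_mul, RCLike.conj_conj, RCLike.conj_ofReal]
    ring
  rw [this, ← ofReal_norm, ← ofReal_norm, RCLike.norm_conj]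

theorem heatKernel_self (φ : ℕ → X → 𝕜) (lam : ℕ → ℝ) (t : ℝ) (x : X) :
    heatKernel φ lam t x x = ((∑' k, heatEigenvalue lam t k * ‖φ k x‖ ^ 2 : ℝ) : 𝕜) := by
  rw [RCLike.ofReal_tsum, heatKernel]
  refine tsum_congr fun k => ?_
  rw [mul_assoc, RCLike.mul_conj]
  push_cast [heatEigenvalue]
  rfl

variable [TopologicalSpace X] [MeasurableSpace X] [BorelSpace X] {ρ : X → X → ℝ} {μ : Measure X}
  [IsProbabilityMeasure μ] {φ : ℕ → X → 𝕜} {lam : ℕ → ℝ} {α : ℝ}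

namespace IsDiffusionMeasureSpace

theorem measurable_basis (hX : IsDiffusionMeasureSpace ρ μ φ lam α) (k : ℕ) :
    Measurable (φ k) :=
  (hX.continuous k).measurable

theorem lam_nonneg (hX : IsDiffusionMeasureSpace ρ μ φ lam α) (k : ℕ) : 0 ≤ lam k :=
  hX.lam_zero ▸ hX.lam_mono (Nat.zero_le k)

/-- A divergent heat series would have the sum zero, against the lower bound for the heat kernel. -/
theorem summable_heat_diag (hX : IsDiffusionMeasureSpace ρ μ φ lam α) {t : ℝ} (ht : 0 < t) (x : X) :
    Summable fun k => heatEigenvalue lam t k * ‖φ k x‖ ^ 2 := by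
  obtain ⟨C, hC, hlow⟩ := hX.heat_lower
  have hs : 0 < min t (1 / 2) := lt_min ht (by norm_num)
  have hs1 : min t (1 / 2) < 1 := (min_le_right _ _).trans_lt (by norm_num)
  have hsum : Summable fun k => heatEigenvalue lam (min t (1 / 2)) k * ‖φ k x‖ ^ 2 := by
    by_contra hns
    have h0 : heatKernel φ lam (min t (1 / 2)) x x = 0 := by
      refine tsum_eq_zero_of_not_summable fun h => hns ?_
      refine (RCLike.summable_ofReal 𝕜).1 (h.congr fun k => ?_)
      rw [mul_assoc, RCLike.mul_conj]
      push_cast [heatEigenvalue]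
      rfl
    have h1 := hlow x _ hs hs1
    rw [h0, map_zero, mul_zero] at h1
    exact absurd (Real.rpow_pos_of_pos hs (-α / 2)) (not_lt.2 h1)
  refine hsum.of_nonneg_of_le (fun k => ?_) fun k => ?_
  · have := heatEigenvalue_pos lam t k
    positivity
  · gcongr
    exact heatEigenvalue_anti lam (min_le_left _ _) k

theorem exists_heat_diag_le (hX : IsDiffusionMeasureSpace ρ μ φ lam α) :
    ∃ C > 0, ∀ x, ∀ t : ℝ, 0 < t → t ≤ 1 →
      ∑' k, heatEigenvalue lam t k * ‖φ k x‖ ^ 2 ≤ C * t ^ (-α / 2) := by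
  obtain ⟨c, hc, C, hC, hup⟩ := hX.heat_upper
  refine ⟨C, hC, fun x t ht ht1 => ?_⟩
  have h := hup x x t ht ht1
  rw [heatKernel_self, RCLike.norm_ofReal] at h
  refine (le_abs_self _).trans (h.trans ?_)
  refine mul_le_of_le_one_right (by positivity) (Real.exp_le_one_iff.2 ?_)
  have : 0 ≤ ρ x x ^ 2 / t := by positivity
  nlinarith

theorem exists_le_heat_diag (hX : IsDiffusionMeasureSpace ρ μ φ lam α) :
    ∃ c > 0, ∀ x, ∀ t : ℝ, 0 < t → t < 1 →
      c * t ^ (-α / 2) ≤ ∑' k, heatEigenvalue lam t k * ‖φ k x‖ ^ 2 := by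
  obtain ⟨C, hC, hlow⟩ := hX.heat_lower
  refine ⟨C⁻¹, inv_pos.2 hC, fun x t ht ht1 => ?_⟩
  have h := hlow x t ht ht1
  rw [heatKernel_self, RCLike.ofReal_re] at h
  rw [inv_mul_le_iff₀ hC]
  exact h

theorem exists_norm_basis_le (hX : IsDiffusionMeasureSpace ρ μ φ lam α) (k : ℕ) :
    ∃ B : ℝ, ∀ x, ‖φ k x‖ ≤ B := by
  obtain ⟨C, hC, hup⟩ := hX.exists_heat_diag_le
  have hu := heatEigenvalue_pos lam 1 k
  refine ⟨1 + C / heatEigenvalue lam 1 k, fun x => ?_⟩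
  have h1 : heatEigenvalue lam 1 k * ‖φ k x‖ ^ 2 ≤ C := by
    refine ((hX.summable_heat_diag one_pos x).le_tsum k fun j _ => ?_).trans
      ((hup x 1 one_pos le_rfl).trans ?_)
    · have := heatEigenvalue_pos lam 1 j
      positivity
    · rw [Real.one_rpow, mul_one]
  have h2 : ‖φ k x‖ ^ 2 ≤ C / heatEigenvalue lam 1 k := by
    rw [le_div_iff₀ hu, mul_comm]; exact h1
  nlinarith [sq_nonneg (‖φ k x‖ - 1), norm_nonneg (φ k x)]

theorem summable_heat_mul (hX : IsDiffusionMeasureSpace ρ μ φ lam α) {t : ℝ} (ht : 0 < t)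
    (x y : X) : Summable fun k => heatEigenvalue lam t k * (‖φ k x‖ * ‖φ k y‖) := by
  refine ((hX.summable_heat_diag ht x).add (hX.summable_heat_diag ht y)).of_nonneg_of_le
    (fun k => ?_) fun k => ?_
  · have := heatEigenvalue_pos lam t k
    positivity
  · rw [← mul_add]
    have := heatEigenvalue_pos lam t k
    gcongr
    nlinarith [sq_nonneg (‖φ k x‖ - ‖φ k y‖), sq_nonneg (‖φ k x‖), sq_nonneg (‖φ k y‖)]

theorem summable_spectralKernel (hX : IsDiffusionMeasureSpace ρ μ φ lam α) {t : ℝ} (ht : 0 < t)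
    {w : ℕ → ℝ} {B : ℝ} (hw : ∀ k, |w k| ≤ B * heatEigenvalue lam t k) (x y : X) :
    Summable fun k => (w k : 𝕜) * φ k x * conj (φ k y) := by
  refine Summable.of_norm_bounded ((hX.summable_heat_mul ht x y).mul_left B) fun k => ?_
  rw [norm_spectralKernel_term, ← mul_assoc B]
  exact mul_le_mul_of_nonneg_right (hw k) (by positivity)

theorem measurable_spectralKernel (hX : IsDiffusionMeasureSpace ρ μ φ lam α) {w : ℕ → ℝ} {x : X}
    (hw : ∀ y, Summable fun k => (w k : 𝕜) * φ k x * conj (φ k y)) :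
    Measurable (spectralKernel φ w x) := by
  refine measurable_of_tendsto_metrizable
    (f := fun n y => ∑ k ∈ Finset.range n, (w k : 𝕜) * φ k x * conj (φ k y)) (fun n => ?_) ?_
  · exact Finset.measurable_fun_sum _ fun k _ =>
      (RCLike.continuous_conj.measurable.comp (hX.measurable_basis k)).const_mul _
  · exact tendsto_pi_nhds.2 fun y => (hw y).hasSum.tendsto_sum_nat

theorem lintegral_enorm_sq_sum (hX : IsDiffusionMeasureSpace ρ μ φ lam α) (c : ℕ → 𝕜)
    (S : Finset ℕ) : ∫⁻ y, ‖∑ k ∈ S, c k * conj (φ k y)‖ₑ ^ 2 ∂μ =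
      ENNReal.ofReal (∑ k ∈ S, ‖c k‖ ^ 2) := by
  let v : Lp 𝕜 2 μ := ∑ k ∈ S, conj (c k) • (hX.memLp k).toLp (φ k)
  have hv : ‖v‖ ^ 2 = ∑ k ∈ S, ‖c k‖ ^ 2 := by
    have h1 : ((‖v‖ ^ 2 : ℝ) : 𝕜) = ((∑ k ∈ S, ‖c k‖ ^ 2 : ℝ) : 𝕜) := by
      rw [RCLike.ofReal_pow, ← inner_self_eq_norm_sq_to_K, hX.orthonormal.inner_sum]
      push_cast
      refine Finset.sum_congr rfl fun k _ => ?_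
      rw [RCLike.conj_conj, RCLike.mul_conj]
    exact_mod_cast h1
  have hae : (v : X → 𝕜) =ᵐ[μ] fun y => ∑ k ∈ S, conj (c k) * φ k y := by
    refine (Lp.coeFn_finsetSum _ _).trans ?_
    have h2 : ∀ᵐ y ∂μ, ∀ k ∈ S, (conj (c k) • (hX.memLp k).toLp (φ k) : Lp 𝕜 2 μ) y =
        conj (c k) * φ k y := by
      refine (ae_ball_iff S.countable_toSet).2 fun k _ => ?_
      filter_upwards [Lp.coeFn_smul (conj (c k)) ((hX.memLp k).toLp (φ k)),
        (hX.memLp k).coeFn_toLp] with y h3 h4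
      rw [h3, Pi.smul_apply, h4, smul_eq_mul]
    filter_upwards [h2] with y hy
    rw [Finset.sum_apply]
    exact Finset.sum_congr rfl hy
  have hnorm : ENNReal.ofReal (‖v‖ ^ 2) = ∫⁻ y, ‖v y‖ₑ ^ 2 ∂μ := by
    rw [ENNReal.ofReal_pow (norm_nonneg _), ofReal_norm, Lp.enorm_def,
      eLpNorm_eq_lintegral_rpow_enorm_toReal two_ne_zero ENNReal.ofNat_ne_top]
    rw [← ENNReal.rpow_natCast, ← ENNReal.rpow_mul]
    simp
  rw [← hv, hnorm]
  refine lintegral_congr_ae ?_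
  filter_upwards [hae] with y hy
  rw [hy, ← ofReal_norm, ← ofReal_norm, ← RCLike.norm_conj, map_sum]
  simp_rw [map_mul, RCLike.conj_conj]

/-- Bessel's inequality for spectral kernels, by Fatou's lemma from the finite sums. -/
theorem lintegral_enorm_sq_spectralKernel_le (hX : IsDiffusionMeasureSpace ρ μ φ lam α) {w : ℕ → ℝ}
    {x : X} (hw : ∀ y, Summable fun k => (w k : 𝕜) * φ k x * conj (φ k y)) {B : ℝ}
    (hB : ∀ n, ∑ k ∈ Finset.range n, w k ^ 2 * ‖φ k x‖ ^ 2 ≤ B) :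
    ∫⁻ y, ‖spectralKernel φ w x y‖ₑ ^ 2 ∂μ ≤ ENNReal.ofReal B := by
  let S : ℕ → X → 𝕜 := fun n y => ∑ k ∈ Finset.range n, (w k : 𝕜) * φ k x * conj (φ k y)
  have hS : ∀ n, Measurable (S n) := fun n => Finset.measurable_fun_sum _ fun k _ =>
      (RCLike.continuous_conj.measurable.comp (hX.measurable_basis k)).const_mul _
  have hlim : ∀ y, liminf (fun n => ‖S n y‖ₑ ^ 2) atTop = ‖spectralKernel φ w x y‖ₑ ^ 2 := fun y =>
    ((ENNReal.continuous_pow 2).tendsto _ |>.comp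
      ((continuous_enorm.tendsto _).comp (hw y).hasSum.tendsto_sum_nat)).liminf_eq
  calc ∫⁻ y, ‖spectralKernel φ w x y‖ₑ ^ 2 ∂μ = ∫⁻ y, liminf (fun n => ‖S n y‖ₑ ^ 2) atTop ∂μ := by
        simp_rw [hlim]
    _ ≤ liminf (fun n => ∫⁻ y, ‖S n y‖ₑ ^ 2 ∂μ) atTop :=
        lintegral_liminf_le fun n => (hS n).enorm.pow_const 2
    _ ≤ ENNReal.ofReal B := by
        refine liminf_le_of_le (by isBoundedDefault) fun b hb => ?_
        obtain ⟨n, hn⟩ := hb.exists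
        refine hn.trans ?_
        rw [hX.lintegral_enorm_sq_sum]
        refine ENNReal.ofReal_le_ofReal (le_trans (le_of_eq ?_) (hB n))
        refine Finset.sum_congr rfl fun k _ => ?_
        rw [norm_mul, RCLike.norm_ofReal, mul_pow, sq_abs]

end IsDiffusionMeasureSpace

end SpectralKernel

/-! ### Uniform `L₁` bounds for the kernels -/

section KernelBounds

variable {𝕜 X : Type*} [RCLike 𝕜] [TopologicalSpace X] [MeasurableSpace X] [BorelSpace X]
  {ρ : X → X → ℝ} {μ : Measure X} [IsProbabilityMeasure μ] {φ : ℕ → X → 𝕜} {lam : ℕ → ℝ} {α : ℝ}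

namespace IsDiffusionMeasureSpace

/-- Mass of a kernel with Gaussian decay outside of a ball, summed over dyadic annuli. The condition
on `R` makes the Gaussian decay beat the growth `2 ^ α` of the volume from one annulus to the next.
The majorized function `g` is measurable, which is not assumed of `ρ`. -/
theorem exists_setLIntegral_gaussian_tail_le (hX : IsDiffusionMeasureSpace ρ μ φ lam α) {c : ℝ}
    (hc : 0 < c) : ∃ C > 0, ∀ (x : X) (R T D : ℝ), 0 < R → 0 < T → 0 ≤ D →
      (α + 1) * Real.log 2 ≤ c * R ^ 2 / T → ∀ g : X → ℝ≥0∞, Measurable g →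
      (∀ y, g y ≤ ENNReal.ofReal (D * Real.exp (-c * (ρ x y ^ 2 / T)))) →
      ∫⁻ y in {y | R < ρ x y}, g y ∂μ ≤
        ENNReal.ofReal (C * (D * R ^ α * Real.exp (-(c * R ^ 2 / T)))) := by
  obtain ⟨C₀, hC₀, hvol⟩ := hX.volume_ball
  refine ⟨C₀ * 2 ^ α * 2, by positivity, fun x R T D hR hT hD hκ g hg hgle => ?_⟩
  have hα := hX.alpha_pos
  set κ := c * R ^ 2 / T with hκdef
  have hκ0 : 0 < κ := by positivity
  have hterm : ∀ i : ℕ, ∫⁻ y in {y | 2 ^ i * R ≤ ρ x y ∧ ρ x y ≤ 2 ^ (i + 1) * R}, g y ∂μ ≤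
      ENNReal.ofReal (C₀ * 2 ^ α * (D * R ^ α * Real.exp (-κ)) * (1 / 2) ^ i) := by
    intro i
    have hg' : ∀ y ∈ {y | 2 ^ i * R ≤ ρ x y ∧ ρ x y ≤ 2 ^ (i + 1) * R},
        g y ≤ ENNReal.ofReal (D * (Real.exp (-κ) * Real.exp (-((α + 1) * Real.log 2)) ^ i)) := by
      intro y hy
      refine (hgle y).trans (ENNReal.ofReal_le_ofReal ?_)
      rw [← Real.exp_nat_mul, ← Real.exp_add]
      gcongr
      have h1 : (2 ^ i * R) ^ 2 ≤ ρ x y ^ 2 := pow_le_pow_left₀ (by positivity) hy.1 2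
      have h2 : (1 : ℝ) + i * 3 ≤ 4 ^ i := by
        have := one_add_mul_le_pow (a := (3 : ℝ)) (by norm_num) i
        norm_num at this
        linarith
      have h3 : 4 ^ i * κ ≤ c * (ρ x y ^ 2 / T) := by
        rw [hκdef, ← mul_div_assoc, ← mul_div_assoc, div_le_div_iff_of_pos_right hT]
        have : (4 : ℝ) ^ i = (2 ^ i) ^ 2 := by rw [← pow_mul, mul_comm, pow_mul]; norm_num
        rw [this]
        nlinarith
      have h4 : (i : ℝ) * ((α + 1) * Real.log 2) ≤ i * κ := by gcongr
      have h5 : (0 : ℝ) ≤ i * κ := by positivity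
      nlinarith
    have hμ : μ {y | 2 ^ i * R ≤ ρ x y ∧ ρ x y ≤ 2 ^ (i + 1) * R} ≤
        ENNReal.ofReal (C₀ * (2 ^ (i + 1) * R) ^ α) :=
      (measure_mono fun y hy => hy.2).trans (hvol x _ (by positivity))
    refine (setLIntegral_le_mul_of_forall_mem_le hg _ hg').trans ((mul_le_mul_right hμ _).trans ?_)
    rw [← ENNReal.ofReal_mul (by positivity)]
    refine ENNReal.ofReal_le_ofReal (le_of_eq ?_)
    have h2 : ((2 : ℝ) ^ (i + 1)) ^ α = 2 ^ α * (2 ^ α) ^ i := by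
      rw [← Real.rpow_natCast, ← Real.rpow_mul (by norm_num), mul_comm,
        Real.rpow_mul (by norm_num), Real.rpow_natCast, pow_succ, mul_comm]
    have h3 : Real.exp (-((α + 1) * Real.log 2)) * 2 ^ α = 1 / 2 := by
      rw [Real.rpow_def_of_pos two_pos, ← Real.exp_add,
        show -((α + 1) * Real.log 2) + Real.log 2 * α = -Real.log 2 by ring, Real.exp_neg,
        Real.exp_log two_pos]
      norm_num
    rw [Real.mul_rpow (by positivity) hR.le, h2, ← h3, mul_pow]
    ring
  have hcover : {y | R < ρ x y} ⊆ ⋃ i : ℕ, {y | 2 ^ i * R ≤ ρ x y ∧ ρ x y ≤ 2 ^ (i + 1) * R} := by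
    intro y hy
    have hy' : R < ρ x y := hy
    obtain ⟨i, hi1, hi2⟩ := exists_nat_pow_near (x := ρ x y / R) (y := (2 : ℝ))
      ((one_le_div hR).2 hy'.le) one_lt_two
    exact Set.mem_iUnion.2 ⟨i, (le_div_iff₀ hR).1 hi1, ((div_lt_iff₀ hR).1 hi2).le⟩
  calc ∫⁻ y in {y | R < ρ x y}, g y ∂μ
      ≤ ∫⁻ y in ⋃ i : ℕ, {y | 2 ^ i * R ≤ ρ x y ∧ ρ x y ≤ 2 ^ (i + 1) * R}, g y ∂μ :=
        lintegral_mono_set hcover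
    _ ≤ ∑' i : ℕ, ∫⁻ y in {y | 2 ^ i * R ≤ ρ x y ∧ ρ x y ≤ 2 ^ (i + 1) * R}, g y ∂μ :=
        lintegral_iUnion_le _ _
    _ ≤ ∑' i : ℕ, ENNReal.ofReal (C₀ * 2 ^ α * (D * R ^ α * Real.exp (-κ)) * (1 / 2) ^ i) :=
        ENNReal.tsum_le_tsum hterm
    _ = ENNReal.ofReal (C₀ * 2 ^ α * 2 * (D * R ^ α * Real.exp (-κ))) := by
        rw [← ENNReal.ofReal_tsum_of_nonneg (fun i => by positivity)
          (summable_geometric_two.mul_left _), tsum_mul_left, tsum_geometric_two]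
        congr 1; ring

/-- For a polynomial `P` bounded by `1` on `[-1, 1]` and the heat operator `A` at time `t`, the
kernel of `A * P(A)` obeys the same bound in `L₂` as the heat kernel. -/
theorem exists_lintegral_sq_polynomial_kernel_le (hX : IsDiffusionMeasureSpace ρ μ φ lam α) :
    ∃ C > 0, ∀ t : ℝ, 0 < t → t ≤ 1 → ∀ P : Polynomial ℝ,
      (∀ u : ℝ, |u| ≤ 1 → |P.eval u| ≤ 1) → ∀ x,
      ∫⁻ y, ‖spectralKernel φ (fun k => heatEigenvalue lam t k * P.eval (heatEigenvalue lam t k))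
        x y‖ₑ ^ 2 ∂μ ≤ ENNReal.ofReal (C * t ^ (-α / 2)) := by
  obtain ⟨C, hC, hup⟩ := hX.exists_heat_diag_le
  refine ⟨C, hC, fun t ht ht1 P hP x => ?_⟩
  have hu0 := fun k => heatEigenvalue_pos lam t k
  have hu1 := fun k => heatEigenvalue_le_one lam ht.le k
  have hP' : ∀ k, |P.eval (heatEigenvalue lam t k)| ≤ 1 := fun k =>
    hP _ (by rw [abs_of_pos (hu0 k)]; exact hu1 k)
  have hw : ∀ k, |heatEigenvalue lam t k * P.eval (heatEigenvalue lam t k)| ≤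
      1 * heatEigenvalue lam t k := fun k => by
    rw [abs_mul, abs_of_pos (hu0 k), one_mul]
    exact mul_le_of_le_one_right (hu0 k).le (hP' k)
  refine hX.lintegral_enorm_sq_spectralKernel_le
    (fun y => hX.summable_spectralKernel ht hw x y) fun n => le_trans ?_ (hup x t ht ht1)
  refine le_trans (Finset.sum_le_sum fun k _ => ?_) ((hX.summable_heat_diag ht x).sum_le_tsum _
    fun k _ => by have := hu0 k; positivity)
  gcongr
  rw [← sq_abs]
  have h1 := hw k
  have h2 := hu1 k
  have h3 := hu0 k
  have h4 := abs_nonneg (heatEigenvalue lam t k * P.eval (heatEigenvalue lam t k))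
  nlinarith

theorem spectralKernel_polynomial (hX : IsDiffusionMeasureSpace ρ μ φ lam α) {t : ℝ} (ht : 0 < t)
    (P : Polynomial ℝ) {m : ℕ} (hm : P.natDegree ≤ m) (x y : X) :
    spectralKernel φ (fun k => heatEigenvalue lam t k * P.eval (heatEigenvalue lam t k)) x y =
      ∑ j ∈ Finset.range (m + 1), (P.coeff j : 𝕜) * heatKernel φ lam ((j + 1 : ℕ) * t) x y := by
  have hs : ∀ j : ℕ, Summable fun k =>
      (heatEigenvalue lam ((j + 1 : ℕ) * t) k : 𝕜) * φ k x * conj (φ k y) := fun j =>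
    hX.summable_spectralKernel (t := ((j + 1 : ℕ) : ℝ) * t) (B := 1) (mul_pos (by positivity) ht)
      (fun k => by rw [abs_of_pos (heatEigenvalue_pos _ _ _), one_mul]) x y
  have h1 : ∀ j : ℕ, (P.coeff j : 𝕜) * heatKernel φ lam ((j + 1 : ℕ) * t) x y =
      ∑' k, (P.coeff j : 𝕜) *
        ((heatEigenvalue lam ((j + 1 : ℕ) * t) k : 𝕜) * φ k x * conj (φ k y)) := fun j => by
    rw [tsum_mul_left]; rfl
  simp_rw [h1]
  rw [← Summable.tsum_finsetSum fun j _ => (hs j).mul_left _]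
  refine tsum_congr fun k => ?_
  beta_reduce
  rw [Polynomial.eval_eq_sum_range' (Nat.lt_succ_of_le hm), Finset.mul_sum]
  push_cast
  rw [Finset.sum_mul, Finset.sum_mul]
  refine Finset.sum_congr rfl fun j _ => ?_
  have h2 := heatEigenvalue_pow lam t k (j + 1)
  push_cast at h2
  rw [← h2]
  push_cast
  ring

theorem exists_norm_polynomial_kernel_le (hX : IsDiffusionMeasureSpace ρ μ φ lam α) :
    ∃ c > 0, ∃ C > 0, ∀ (t : ℝ) (m : ℕ), 0 < t → (m + 1) * t ≤ 1 → ∀ P : Polynomial ℝ,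
      P.natDegree ≤ m → ∀ x y,
      ‖spectralKernel φ (fun k => heatEigenvalue lam t k * P.eval (heatEigenvalue lam t k)) x y‖ ≤
        (∑ j ∈ Finset.range (m + 1), |P.coeff j|) * (C * t ^ (-α / 2)) *
          Real.exp (-c * (ρ x y ^ 2 / ((m + 1) * t))) := by
  obtain ⟨c, hc, C, hC, hup⟩ := hX.heat_upper
  refine ⟨c, hc, C, hC, fun t m ht hmt P hP x y => ?_⟩
  rw [hX.spectralKernel_polynomial ht P hP]
  refine (norm_sum_le _ _).trans ?_
  rw [Finset.sum_mul, Finset.sum_mul]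
  refine Finset.sum_le_sum fun j hj => ?_
  rw [norm_mul, RCLike.norm_ofReal, mul_assoc]
  have hjm : ((j + 1 : ℕ) : ℝ) ≤ m + 1 := by
    have := Finset.mem_range.1 hj
    exact_mod_cast this
  have hj1 : (1 : ℝ) ≤ ((j + 1 : ℕ) : ℝ) := by exact_mod_cast Nat.le_add_left 1 j
  have hjt : ((j + 1 : ℕ) : ℝ) * t ≤ (m + 1) * t := by gcongr
  have hjt0 : 0 < ((j + 1 : ℕ) : ℝ) * t := by positivity
  have hα := hX.alpha_pos
  refine mul_le_mul_of_nonneg_left ?_ (abs_nonneg _)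
  refine (hup x y _ hjt0 (hjt.trans hmt)).trans ?_
  have h1 : (((j + 1 : ℕ) : ℝ) * t) ^ (-α / 2) ≤ t ^ (-α / 2) :=
    Real.rpow_le_rpow_of_nonpos ht (le_mul_of_one_le_left ht.le hj1) (by linarith)
  have h2 : Real.exp (-c * (ρ x y ^ 2 / (((j + 1 : ℕ) : ℝ) * t))) ≤
      Real.exp (-c * (ρ x y ^ 2 / ((m + 1) * t))) := by
    rw [Real.exp_le_exp, neg_mul, neg_mul, neg_le_neg_iff]
    gcongr
  gcongr

/-- Let `A` be the heat operator at time `t`. Up to a factor `3 ^ m`, the kernel of `A * P(A)` has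
the Gaussian decay of the heat kernel at time `(m + 1) t`, so that its mass outside of the ball of
radius `L (m + 1) √t` is negligible for a large constant `L`. Inside that ball its mass is bounded
through its `L₂` norm. If `(m + 1) t > 1`, where Gaussian bounds are not at hand, the whole space
takes the place of the ball. -/
theorem exists_lintegral_polynomial_kernel_le (hX : IsDiffusionMeasureSpace ρ μ φ lam α) :
    ∃ C > 0, ∀ t : ℝ, 0 < t → t ≤ 1 → ∀ (m : ℕ) (P : Polynomial ℝ), P.natDegree ≤ m →
      (∀ u : ℝ, |u| ≤ 1 → |P.eval u| ≤ 1) → ∑ j ∈ Finset.range (m + 1), |P.coeff j| ≤ 3 ^ m → ∀ x,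
      ∫⁻ y, ‖spectralKernel φ (fun k => heatEigenvalue lam t k * P.eval (heatEigenvalue lam t k))
        x y‖ₑ ∂μ ≤ ENNReal.ofReal (C * (m + 1 : ℝ) ^ α) := by
  have hα := hX.alpha_pos
  obtain ⟨C₀, hC₀, hvol⟩ := hX.volume_ball
  obtain ⟨C₁, hC₁, hL2⟩ := hX.exists_lintegral_sq_polynomial_kernel_le
  obtain ⟨c, hc, C₂, hC₂, hptw⟩ := hX.exists_norm_polynomial_kernel_le
  obtain ⟨C₃, hC₃, htail⟩ := hX.exists_setLIntegral_gaussian_tail_le hc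
  have hlog2 : 0 < Real.log 2 := Real.log_pos one_lt_two
  have hlog3 : 0 < Real.log 3 := Real.log_pos (by norm_num)
  set M := (α + 1) * Real.log 2 + Real.log 3 with hM
  have hM0 : 0 < M := by positivity
  -- The choice of `L`: the Gaussian factor `exp (-M (m + 1))` at radius `L (m + 1) √t` compensates
  -- `3 ^ m` as well as the growth of the volume.
  set L := Real.sqrt (M / c) with hLdef
  have hL0 : 0 < L := Real.sqrt_pos.2 (by positivity)
  have hL2' : c * L ^ 2 = M := by
    rw [hLdef, Real.sq_sqrt (by positivity)]; field_simp
  refine ⟨C₁ + C₀ * L ^ α + C₃ * C₂ * L ^ α + 1, by positivity,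
    fun t ht ht1 m P hdeg hP hcoeff x => ?_⟩
  set w : ℕ → ℝ := fun k => heatEigenvalue lam t k * P.eval (heatEigenvalue lam t k) with hw
  have hwle : ∀ k, |w k| ≤ 1 * heatEigenvalue lam t k := fun k => by
    have h0 := heatEigenvalue_pos lam t k
    rw [hw, abs_mul, abs_of_pos h0, one_mul]
    refine mul_le_of_le_one_right h0.le (hP _ ?_)
    rw [abs_of_pos h0]
    exact heatEigenvalue_le_one lam ht.le k
  have hmeas : Measurable fun y => ‖spectralKernel φ w x y‖ₑ :=
    (hX.measurable_spectralKernel fun y => hX.summable_spectralKernel ht hwle x y).enorm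
  have hm1 : (1 : ℝ) ≤ m + 1 := by linarith [m.cast_nonneg (α := ℝ)]
  have hmα : (1 : ℝ) ≤ (m + 1 : ℝ) ^ α := Real.one_le_rpow hm1 hα.le
  set ε := t ^ (α / 2) with hε
  have hε0 : 0 < ε := Real.rpow_pos_of_pos ht _
  have hεinv : t ^ (-α / 2) = ε⁻¹ := by
    rw [hε, ← Real.rpow_neg ht.le]; congr 1; ring
  -- `2 a ≤ ε a² + ε⁻¹` turns the `L₂` bound into an `L₁` bound on sets of measure about `ε`.
  have hset : ∀ (S : Set X) (V : ℝ), 0 ≤ V → μ S ≤ ENNReal.ofReal V →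
      ∫⁻ y in S, ‖spectralKernel φ w x y‖ₑ ∂μ ≤ ENNReal.ofReal (C₁ + V * ε⁻¹) := by
    intro S V hV hS
    have hpt : ∀ y, ‖spectralKernel φ w x y‖ₑ ≤
        ENNReal.ofReal ε * ‖spectralKernel φ w x y‖ₑ ^ 2 + ENNReal.ofReal ε⁻¹ := by
      intro y
      rw [← ofReal_norm, ← ENNReal.ofReal_pow (norm_nonneg _), ← ENNReal.ofReal_mul hε0.le,
        ← ENNReal.ofReal_add (by positivity) (by positivity)]
      refine ENNReal.ofReal_le_ofReal ?_
      set a := ‖spectralKernel φ w x y‖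
      have h1 : ε * a ^ 2 + ε⁻¹ - a = ε * ((a - ε⁻¹ / 2) ^ 2 + 3 / 4 * ε⁻¹ ^ 2) := by
        field_simp; ring
      have h2 : 0 ≤ ε * ((a - ε⁻¹ / 2) ^ 2 + 3 / 4 * ε⁻¹ ^ 2) := by positivity
      linarith
    calc ∫⁻ y in S, ‖spectralKernel φ w x y‖ₑ ∂μ
        ≤ ∫⁻ y in S, (ENNReal.ofReal ε * ‖spectralKernel φ w x y‖ₑ ^ 2 + ENNReal.ofReal ε⁻¹) ∂μ :=
          lintegral_mono hpt
      _ = ENNReal.ofReal ε * ∫⁻ y in S, ‖spectralKernel φ w x y‖ₑ ^ 2 ∂μ +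
          ENNReal.ofReal ε⁻¹ * μ S := by
          rw [lintegral_add_right _ measurable_const, setLIntegral_const,
            lintegral_const_mul _ (hmeas.pow_const 2)]
      _ ≤ ENNReal.ofReal ε * ENNReal.ofReal (C₁ * t ^ (-α / 2)) +
          ENNReal.ofReal ε⁻¹ * ENNReal.ofReal V := by
          gcongr
          exact (setLIntegral_le_lintegral _ _).trans (hL2 t ht ht1 P hP x)
      _ = ENNReal.ofReal (C₁ + V * ε⁻¹) := by
          rw [← ENNReal.ofReal_mul hε0.le, ← ENNReal.ofReal_mul (by positivity),
            ← ENNReal.ofReal_add (by positivity) (by positivity), hεinv]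
          congr 1
          field_simp
  rcases le_or_gt ((m + 1) * t) 1 with hmt | hmt
  · set R := L * (m + 1) * Real.sqrt t with hR
    have hR0 : 0 < R := by have := Real.sqrt_pos.2 ht; positivity
    have hRα : R ^ α = L ^ α * (m + 1 : ℝ) ^ α * ε := by
      rw [hR, Real.mul_rpow (by positivity) (Real.sqrt_nonneg t),
        Real.mul_rpow hL0.le (by positivity), hε, Real.sqrt_eq_rpow, ← Real.rpow_mul ht.le]
      congr 2; ring
    have hκ : c * R ^ 2 / ((m + 1) * t) = M * (m + 1) := by
      rw [hR, mul_pow, mul_pow, Real.sq_sqrt ht.le, ← hL2']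
      field_simp
    have hin := hset {y | ρ x y ≤ R} (C₀ * R ^ α) (by positivity) (hvol x R hR0)
    have hout := htail x R ((m + 1) * t) (3 ^ m * (C₂ * t ^ (-α / 2))) hR0 (by positivity)
      (by positivity) (by rw [hκ]; nlinarith) _ hmeas fun y => by
        rw [← ofReal_norm]
        refine ENNReal.ofReal_le_ofReal ((hptw t m ht hmt P hdeg x y).trans ?_)
        gcongr
    have h3 : (3 : ℝ) ^ m * Real.exp (-(M * (m + 1))) ≤ 1 := by
      rw [← Real.exp_log (show (0 : ℝ) < 3 by norm_num), ← Real.exp_nat_mul, ← Real.exp_add,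
        Real.exp_le_one_iff]
      have : Real.log 3 ≤ M := by rw [hM]; nlinarith
      have : (m : ℝ) * Real.log 3 ≤ m * M := by gcongr
      linarith
    calc ∫⁻ y, ‖spectralKernel φ w x y‖ₑ ∂μ
        = ∫⁻ y in {y | ρ x y ≤ R} ∪ {y | R < ρ x y}, ‖spectralKernel φ w x y‖ₑ ∂μ := by
          have : {y | ρ x y ≤ R} ∪ {y | R < ρ x y} = Set.univ := by
            ext y; simpa using le_or_gt (ρ x y) R
          rw [this, Measure.restrict_univ]
      _ ≤ _ := lintegral_union_le _ _ _
      _ ≤ _ := add_le_add hin hout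
      _ ≤ ENNReal.ofReal ((C₁ + C₀ * L ^ α + C₃ * C₂ * L ^ α + 1) * (m + 1 : ℝ) ^ α) := by
          rw [← ENNReal.ofReal_add (by positivity) (by positivity)]
          refine ENNReal.ofReal_le_ofReal ?_
          rw [hκ, hRα, hεinv]
          have e1 : C₀ * (L ^ α * (m + 1 : ℝ) ^ α * ε) * ε⁻¹ = C₀ * L ^ α * (m + 1 : ℝ) ^ α := by
            field_simp
          have e2 : C₃ * (3 ^ m * (C₂ * ε⁻¹) * (L ^ α * (m + 1 : ℝ) ^ α * ε) *
              Real.exp (-(M * (m + 1)))) = C₃ * C₂ * L ^ α * (m + 1 : ℝ) ^ α *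
                (3 ^ m * Real.exp (-(M * (m + 1)))) := by
            field_simp
          rw [e1, e2]
          have e3 : C₃ * C₂ * L ^ α * (m + 1 : ℝ) ^ α * (3 ^ m * Real.exp (-(M * (m + 1)))) ≤
              C₃ * C₂ * L ^ α * (m + 1 : ℝ) ^ α := mul_le_of_le_one_right (by positivity) h3
          have e4 : C₁ ≤ C₁ * (m + 1 : ℝ) ^ α := le_mul_of_one_le_right hC₁.le hmα
          nlinarith
  · have h := hset Set.univ 1 zero_le_one (by simp)
    rw [Measure.restrict_univ] at h
    refine h.trans (ENNReal.ofReal_le_ofReal ?_)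
    have h1 : ε⁻¹ ≤ (m + 1 : ℝ) ^ α := by
      have h2 : t⁻¹ ≤ m + 1 := by
        rw [inv_le_iff_one_le_mul₀ ht]; exact hmt.le
      calc ε⁻¹ = t⁻¹ ^ (α / 2) := by rw [hε, Real.inv_rpow ht.le]
        _ ≤ (m + 1 : ℝ) ^ (α / 2) := Real.rpow_le_rpow (by positivity) h2 (by positivity)
        _ ≤ (m + 1 : ℝ) ^ α := Real.rpow_le_rpow_of_exponent_le hm1 (by linarith)
    have e4 : C₁ ≤ C₁ * (m + 1 : ℝ) ^ α := le_mul_of_one_le_right hC₁.le hmα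
    have e5 : 0 ≤ C₀ * L ^ α * (m + 1 : ℝ) ^ α := by positivity
    have e6 : 0 ≤ C₃ * C₂ * L ^ α * (m + 1 : ℝ) ^ α := by positivity
    linarith

/-- The smoothly truncated spectral projections have kernels that are bounded in `L₁`, uniformly in
the scale `t`: expand the cutoff in Chebyshev polynomials. -/
theorem exists_lintegral_cutoff_kernel_le (hX : IsDiffusionMeasureSpace ρ μ φ lam α) {b : ℝ}
    (hb : 0 < b) : ∃ C > 0, ∀ t : ℝ, 0 < t → t ≤ 1 → ∀ x,
      ∫⁻ y, ‖spectralKernel φ (fun k => heatEigenvalue lam t k *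
        cutoffDiv b (heatEigenvalue lam t k)) x y‖ₑ ∂μ ≤ ENNReal.ofReal C := by
  obtain ⟨C, hC, hker⟩ := hX.exists_lintegral_polynomial_kernel_le
  obtain ⟨a, ha, hsum⟩ := exists_chebyshev_cutoff hb ⌈α⌉₊
  have hα := hX.alpha_pos
  have hpow : ∀ n : ℤ, (n.natAbs + 1 : ℝ) ^ α ≤ (n.natAbs + 1 : ℝ) ^ ⌈α⌉₊ := fun n => by
    rw [← Real.rpow_natCast]
    exact Real.rpow_le_rpow_of_exponent_le (by linarith [n.natAbs.cast_nonneg (α := ℝ)])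
      (Nat.le_ceil α)
  have hasum : Summable fun n => |a n| := by
    refine ha.of_nonneg_of_le (fun _ => abs_nonneg _) fun n => ?_
    exact le_mul_of_one_le_right (abs_nonneg _)
      (one_le_pow₀ (by linarith [n.natAbs.cast_nonneg (α := ℝ)]))
  refine ⟨C * ∑' n : ℤ, |a n| * (n.natAbs + 1 : ℝ) ^ ⌈α⌉₊ + 1, ?_, fun t ht ht1 x => ?_⟩
  · have : 0 ≤ ∑' n : ℤ, |a n| * (n.natAbs + 1 : ℝ) ^ ⌈α⌉₊ := tsum_nonneg fun n => by positivity
    positivity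
  have hu1 : ∀ k, |heatEigenvalue lam t k| ≤ 1 := fun k => by
    rw [abs_of_pos (heatEigenvalue_pos _ _ _)]
    exact heatEigenvalue_le_one lam ht.le k
  let w : ℤ → ℕ → ℝ := fun n k =>
    heatEigenvalue lam t k * (Polynomial.Chebyshev.T ℝ n).eval (heatEigenvalue lam t k)
  have hwle : ∀ n k, |w n k| ≤ 1 * heatEigenvalue lam t k := fun n k => by
    have h0 := heatEigenvalue_pos lam t k
    rw [abs_mul, abs_of_pos h0, one_mul]
    exact mul_le_of_le_one_right h0.le
      (Polynomial.Chebyshev.abs_eval_T_real_le_one n (hu1 k))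
  have hmeas : ∀ n, Measurable fun y => ‖spectralKernel φ (w n) x y‖ₑ := fun n =>
    (hX.measurable_spectralKernel fun y => hX.summable_spectralKernel ht (hwle n) x y).enorm
  have hexp : ∀ y, spectralKernel φ (fun k => heatEigenvalue lam t k *
      cutoffDiv b (heatEigenvalue lam t k)) x y =
      ∑' n : ℤ, (a n : 𝕜) * spectralKernel φ (w n) x y := by
    intro y
    have hdouble : Summable (Function.uncurry fun (n : ℤ) (k : ℕ) =>
        (a n : 𝕜) * ((w n k : 𝕜) * φ k x * conj (φ k y))) := by
      refine Summable.of_norm_bounded (hasum.mul_of_nonneg (hX.summable_heat_mul ht x y)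
        (fun _ => abs_nonneg _) fun k => ?_) fun ⟨n, k⟩ => ?_
      · have := heatEigenvalue_pos lam t k
        positivity
      · simp only [Function.uncurry]
        rw [norm_mul, RCLike.norm_ofReal, norm_spectralKernel_term]
        gcongr
        simpa using hwle n k
    simp_rw [spectralKernel, ← tsum_mul_left]
    rw [← hdouble.tsum_comm]
    refine tsum_congr fun k => ?_
    rw [← (hsum _ (hu1 k)).tsum_eq, ← tsum_mul_left, RCLike.ofReal_tsum, ← tsum_mul_right,
      ← tsum_mul_right]
    refine tsum_congr fun n => ?_
    simp only [w]
    push_cast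
    ring
  calc ∫⁻ y, ‖spectralKernel φ (fun k => heatEigenvalue lam t k *
        cutoffDiv b (heatEigenvalue lam t k)) x y‖ₑ ∂μ
      ≤ ∫⁻ y, ∑' n : ℤ, ENNReal.ofReal |a n| * ‖spectralKernel φ (w n) x y‖ₑ ∂μ := by
        refine lintegral_mono fun y => ?_
        rw [hexp]
        refine enorm_tsum_le_tsum_enorm.trans (le_of_eq ?_)
        refine tsum_congr fun n => ?_
        rw [enorm_mul, ← ofReal_norm, RCLike.norm_ofReal]
    _ = ∑' n : ℤ, ENNReal.ofReal |a n| * ∫⁻ y, ‖spectralKernel φ (w n) x y‖ₑ ∂μ := by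
        rw [lintegral_tsum fun n => ((hmeas n).const_mul _).aemeasurable]
        exact tsum_congr fun n => lintegral_const_mul _ (hmeas n)
    _ ≤ ∑' n : ℤ, ENNReal.ofReal (C * (|a n| * (n.natAbs + 1 : ℝ) ^ ⌈α⌉₊)) := by
        refine ENNReal.tsum_le_tsum fun n => ?_
        refine (mul_le_mul_right (hker t ht ht1 n.natAbs (Polynomial.Chebyshev.T ℝ n)
          (natDegree_T_le n) (fun u hu => Polynomial.Chebyshev.abs_eval_T_real_le_one n hu)
          (sum_abs_coeff_T_le _ n) x) _).trans ?_
        rw [← ENNReal.ofReal_mul (abs_nonneg _)]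
        refine ENNReal.ofReal_le_ofReal ?_
        rw [mul_left_comm]
        gcongr
        exact hpow n
    _ = ENNReal.ofReal (C * ∑' n : ℤ, |a n| * (n.natAbs + 1 : ℝ) ^ ⌈α⌉₊) := by
        rw [← ENNReal.ofReal_tsum_of_nonneg (fun n => by positivity) (ha.mul_left C), tsum_mul_left]
    _ ≤ _ := ENNReal.ofReal_le_ofReal (by linarith)

end IsDiffusionMeasureSpace

end KernelBounds

/-! ### Growth of the dimension of the spaces of diffusion polynomials -/

section Counting

variable {𝕜 X : Type*} [RCLike 𝕜] [TopologicalSpace X] [MeasurableSpace X] [BorelSpace X]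
  {ρ : X → X → ℝ} {μ : Measure X} [IsProbabilityMeasure μ] {φ : ℕ → X → 𝕜} {lam : ℕ → ℝ} {α : ℝ}

namespace IsDiffusionMeasureSpace

theorem finite_setOf_lam_le (hX : IsDiffusionMeasureSpace ρ μ φ lam α) (N : ℝ) :
    {k | lam k ≤ N}.Finite := by
  have h := hX.lam_tendsto.eventually_gt_atTop N
  rw [← Nat.cofinite_eq_atTop, eventually_cofinite] at h
  exact h.subset fun k hk => not_lt.2 hk

theorem lintegral_sum_norm_sq (hX : IsDiffusionMeasureSpace ρ μ φ lam α) (S : Finset ℕ) :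
    ∫⁻ y, ENNReal.ofReal (∑ k ∈ S, ‖φ k y‖ ^ 2) ∂μ = S.card := by
  have h1 : ∀ k, ∫⁻ y, ENNReal.ofReal (‖φ k y‖ ^ 2) ∂μ = 1 := by
    intro k
    have h := hX.lintegral_enorm_sq_sum (fun _ => 1) {k}
    simp only [Finset.sum_singleton, one_mul, norm_one, one_pow, ENNReal.ofReal_one] at h
    rw [← h]
    refine lintegral_congr fun y => ?_
    rw [← ofReal_norm, RCLike.norm_conj, ENNReal.ofReal_pow (norm_nonneg _)]
  simp_rw [ENNReal.ofReal_sum_of_nonneg fun k (_ : k ∈ S) => sq_nonneg ‖φ k _‖]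
  rw [lintegral_finsetSum _ fun k _ =>
    ((hX.measurable_basis k).norm.pow_const 2).ennreal_ofReal]
  rw [Finset.sum_congr rfl fun k _ => h1 k]
  simp

theorem exists_ncard_le (hX : IsDiffusionMeasureSpace ρ μ φ lam α) :
    ∃ C > 0, ∀ N : ℝ, 1 ≤ N → ({k | lam k ≤ N}.ncard : ℝ) ≤ C * N ^ α := by
  obtain ⟨C, hC, hup⟩ := hX.exists_heat_diag_le
  refine ⟨Real.exp 1 * C, by positivity, fun N hN => ?_⟩
  have hN0 : 0 < N := one_pos.trans_le hN
  set S := (hX.finite_setOf_lam_le N).toFinset with hS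
  have ht1 : (N ^ 2)⁻¹ ≤ 1 := inv_le_one_of_one_le₀ (one_le_pow₀ hN)
  have ht : 0 < (N ^ 2)⁻¹ := by positivity
  have hpow : ((N ^ 2)⁻¹ : ℝ) ^ (-α / 2) = N ^ α := by
    rw [Real.inv_rpow (by positivity), ← Real.rpow_neg (by positivity), ← Real.rpow_natCast,
      ← Real.rpow_mul hN0.le]
    congr 1; push_cast; ring
  have hpt : ∀ y, ∑ k ∈ S, ‖φ k y‖ ^ 2 ≤ Real.exp 1 * C * N ^ α := by
    intro y
    have h1 : ∑ k ∈ S, heatEigenvalue lam (N ^ 2)⁻¹ k * ‖φ k y‖ ^ 2 ≤ C * N ^ α := by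
      rw [← hpow]
      refine le_trans ((hX.summable_heat_diag ht y).sum_le_tsum _ fun k _ => ?_) (hup y _ ht ht1)
      have := heatEigenvalue_pos lam (N ^ 2)⁻¹ k
      positivity
    calc ∑ k ∈ S, ‖φ k y‖ ^ 2
        ≤ ∑ k ∈ S, Real.exp 1 * (heatEigenvalue lam (N ^ 2)⁻¹ k * ‖φ k y‖ ^ 2) := by
          refine Finset.sum_le_sum fun k hk => ?_
          have hk' : lam k ≤ N := by simpa [hS] using hk
          have h2 : lam k ^ 2 * (N ^ 2)⁻¹ ≤ 1 := by
            rw [← div_eq_mul_inv, div_le_one (by positivity)]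
            exact pow_le_pow_left₀ (hX.lam_nonneg k) hk' 2
          have h3 : 1 ≤ Real.exp 1 * heatEigenvalue lam (N ^ 2)⁻¹ k := by
            rw [heatEigenvalue, ← Real.exp_add]
            exact Real.one_le_exp (by linarith)
          rw [← mul_assoc]
          exact le_mul_of_one_le_left (by positivity) h3
      _ ≤ _ := by
          rw [← Finset.mul_sum, mul_assoc]
          gcongr
  have h := hX.lintegral_sum_norm_sq S
  have h2 : ∫⁻ y, ENNReal.ofReal (∑ k ∈ S, ‖φ k y‖ ^ 2) ∂μ ≤
      ENNReal.ofReal (Real.exp 1 * C * N ^ α) := by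
    refine (lintegral_mono fun y => ENNReal.ofReal_le_ofReal (hpt y)).trans (le_of_eq ?_)
    rw [lintegral_const, measure_univ, mul_one]
  rw [h, ← ENNReal.ofReal_natCast, ENNReal.ofReal_le_ofReal_iff (by positivity)] at h2
  rwa [Set.ncard_eq_toFinset_card _ (hX.finite_setOf_lam_le N)]

theorem exists_le_ncard (hX : IsDiffusionMeasureSpace ρ μ φ lam α) :
    ∃ c > 0, ∃ N₀ : ℝ, 1 ≤ N₀ ∧ ∀ N : ℝ, N₀ ≤ N → c * N ^ α ≤ ({k | lam k ≤ N}.ncard : ℝ) := by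
  obtain ⟨C, hC, hup⟩ := hX.exists_heat_diag_le
  obtain ⟨c, hc, hlow⟩ := hX.exists_le_heat_diag
  -- At time `t = β / N²` the frequencies above `N` carry at most half of the trace.
  set Q : ℝ := 1 + 2 * C * 2 ^ (α / 2) / c with hQ
  have hQ1 : 1 < Q := by
    rw [hQ]
    have : 0 < 2 * C * 2 ^ (α / 2) / c := by positivity
    linarith
  have hQ0 : 0 < Q := by linarith
  set β := 2 * Real.log Q with hβ
  have hβ0 : 0 < β := by have := Real.log_pos hQ1; positivity
  have hexp : Real.exp (-(β / 2)) * (C * 2 ^ (α / 2)) ≤ c / 2 := by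
    rw [hβ, mul_div_cancel_left₀ _ two_ne_zero, Real.exp_neg, Real.exp_log hQ0,
      inv_mul_le_iff₀ hQ0, hQ]
    have : (1 + 2 * C * 2 ^ (α / 2) / c) * (c / 2) = c / 2 + C * 2 ^ (α / 2) := by
      field_simp
    rw [this]; linarith
  refine ⟨c / 2 * β ^ (-α / 2), by positivity, β + 1, by linarith, fun N hN => ?_⟩
  have hN1 : 1 ≤ N := by linarith
  have hN0 : 0 < N := by linarith
  set S := (hX.finite_setOf_lam_le N).toFinset with hS
  set t := β / N ^ 2 with htdef
  have ht : 0 < t := by positivity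
  have ht1 : t < 1 := by
    rw [htdef, div_lt_one (by positivity)]; nlinarith
  have hpow : t ^ (-α / 2) = β ^ (-α / 2) * N ^ α := by
    rw [htdef, Real.div_rpow hβ0.le (by positivity), div_eq_mul_inv,
      ← Real.rpow_neg (by positivity), ← Real.rpow_natCast N 2, ← Real.rpow_mul hN0.le]
    congr 2; push_cast; ring
  have hpt : ∀ y, c / 2 * β ^ (-α / 2) * N ^ α ≤ ∑ k ∈ S, ‖φ k y‖ ^ 2 := by
    intro y
    have h1 := hlow y t ht ht1
    have h2 := hup y (t / 2) (by positivity) (by linarith)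
    have hs := hX.summable_heat_diag (t := t / 2) (by positivity) y
    have hfin : HasSum (fun k => if k ∈ S then ‖φ k y‖ ^ 2 else 0) (∑ k ∈ S, ‖φ k y‖ ^ 2) := by
      have : HasSum (fun k => if k ∈ S then ‖φ k y‖ ^ 2 else 0)
          (∑ k ∈ S, if k ∈ S then ‖φ k y‖ ^ 2 else 0) :=
        hasSum_sum_of_ne_finset_zero fun k hk => if_neg hk
      rwa [Finset.sum_congr rfl fun k hk => if_pos hk] at this
    have h3 : ∑' k, heatEigenvalue lam t k * ‖φ k y‖ ^ 2 ≤ ∑ k ∈ S, ‖φ k y‖ ^ 2 +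
        Real.exp (-(β / 2)) * ∑' k, heatEigenvalue lam (t / 2) k * ‖φ k y‖ ^ 2 := by
      refine hasSum_le (fun k => ?_) (hX.summable_heat_diag ht y).hasSum
        (hfin.add (hs.hasSum.mul_left _))
      have hu := heatEigenvalue_pos lam (t / 2) k
      by_cases hk : k ∈ S
      · rw [if_pos hk]
        have := mul_le_of_le_one_left (sq_nonneg ‖φ k y‖) (heatEigenvalue_le_one lam ht.le k)
        have : 0 ≤ Real.exp (-(β / 2)) * (heatEigenvalue lam (t / 2) k * ‖φ k y‖ ^ 2) := by
          positivity
        linarith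
      · rw [if_neg hk, zero_add, ← mul_assoc]
        gcongr
        rw [heatEigenvalue, heatEigenvalue, ← Real.exp_add, Real.exp_le_exp]
        have hk' : N < lam k := by simpa [hS] using hk
        have h4 : N ^ 2 * t = β := by rw [htdef]; field_simp
        have h5 : N ^ 2 * t ≤ lam k ^ 2 * t := by gcongr
        linarith
    have h6 : (t / 2) ^ (-α / 2) = 2 ^ (α / 2) * t ^ (-α / 2) := by
      rw [Real.div_rpow ht.le zero_le_two, div_eq_mul_inv, ← Real.rpow_neg zero_le_two, mul_comm]
      congr 2; ring
    rw [h6] at h2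
    have h7 : 0 < t ^ (-α / 2) := by positivity
    have h8 : Real.exp (-(β / 2)) * ∑' k, heatEigenvalue lam (t / 2) k * ‖φ k y‖ ^ 2 ≤
        c / 2 * t ^ (-α / 2) := by
      calc _ ≤ Real.exp (-(β / 2)) * (C * (2 ^ (α / 2) * t ^ (-α / 2))) := by gcongr
        _ = Real.exp (-(β / 2)) * (C * 2 ^ (α / 2)) * t ^ (-α / 2) := by ring
        _ ≤ _ := by gcongr
    rw [mul_assoc, ← hpow]
    linarith
  have h := hX.lintegral_sum_norm_sq S
  have h2 : ENNReal.ofReal (c / 2 * β ^ (-α / 2) * N ^ α) ≤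
      ∫⁻ y, ENNReal.ofReal (∑ k ∈ S, ‖φ k y‖ ^ 2) ∂μ := by
    refine le_trans (le_of_eq ?_) (lintegral_mono fun y => ENNReal.ofReal_le_ofReal (hpt y))
    rw [lintegral_const, measure_univ, mul_one]
  rw [h, ← ENNReal.ofReal_natCast, ENNReal.ofReal_le_ofReal_iff (by positivity)] at h2
  rwa [Set.ncard_eq_toFinset_card _ (hX.finite_setOf_lam_le N)]

end IsDiffusionMeasureSpace

end Counting

/-! ### Diffusion polynomials in `Lₚ` -/

section PolyLp

variable {𝕜 X : Type*} [RCLike 𝕜] [TopologicalSpace X] [MeasurableSpace X] [BorelSpace X]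
  {ρ : X → X → ℝ} {μ : Measure X} [IsProbabilityMeasure μ] {φ : ℕ → X → 𝕜} {lam : ℕ → ℝ} {α : ℝ}

namespace IsDiffusionMeasureSpace

theorem memLp_basis (hX : IsDiffusionMeasureSpace ρ μ φ lam α) (p : ℝ≥0∞) (k : ℕ) :
    MemLp (φ k) p μ := by
  obtain ⟨B, hB⟩ := hX.exists_norm_basis_le k
  exact MemLp.of_bound (hX.measurable_basis k).aestronglyMeasurable B (ae_of_all _ hB)

/-- The basis function `φ k` as an element of `Lₚ`. -/
noncomputable def basisLp (hX : IsDiffusionMeasureSpace ρ μ φ lam α) (p : ℝ≥0∞) (k : ℕ) :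
    Lp 𝕜 p μ :=
  (hX.memLp_basis p k).toLp (φ k)

theorem coeFn_basisLp (hX : IsDiffusionMeasureSpace ρ μ φ lam α) (p : ℝ≥0∞) (k : ℕ) :
    hX.basisLp p k =ᵐ[μ] φ k :=
  (hX.memLp_basis p k).coeFn_toLp

theorem coeFn_sum_smul_basisLp (hX : IsDiffusionMeasureSpace ρ μ φ lam α) (p : ℝ≥0∞)
    (S : Finset ℕ) (c : ℕ → 𝕜) :
    (∑ k ∈ S, c k • hX.basisLp p k : Lp 𝕜 p μ) =ᵐ[μ] fun y => ∑ k ∈ S, c k * φ k y := by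
  refine (Lp.coeFn_finsetSum _ _).trans ?_
  have h : ∀ᵐ y ∂μ, ∀ k ∈ S, (c k • hX.basisLp p k : Lp 𝕜 p μ) y = c k * φ k y := by
    refine (ae_ball_iff S.countable_toSet).2 fun k _ => ?_
    filter_upwards [Lp.coeFn_smul (c k) (hX.basisLp p k), hX.coeFn_basisLp p k] with y h1 h2
    rw [h1, Pi.smul_apply, h2, smul_eq_mul]
  filter_upwards [h] with y hy
  rw [Finset.sum_apply]
  exact Finset.sum_congr rfl hy

theorem linearIndependent_basisLp (hX : IsDiffusionMeasureSpace ρ μ φ lam α) (p : ℝ≥0∞) :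
    LinearIndependent 𝕜 (hX.basisLp p) := by
  rw [linearIndependent_iff']
  intro S c hc k hk
  have h0 : (fun y => ∑ k ∈ S, c k * φ k y) =ᵐ[μ] 0 := by
    refine (hX.coeFn_sum_smul_basisLp p S c).symm.trans ?_
    rw [hc]
    exact Lp.coeFn_zero _ _ _
  have h1 := hX.lintegral_enorm_sq_sum (fun k => conj (c k)) S
  have h2 : ∫⁻ y, ‖∑ k ∈ S, conj (c k) * conj (φ k y)‖ₑ ^ 2 ∂μ = 0 := by
    rw [← lintegral_zero (μ := μ)]
    refine lintegral_congr_ae ?_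
    filter_upwards [h0] with y hy
    simp_rw [← map_mul, ← map_sum]
    rw [hy]
    simp
  rw [h2, eq_comm, ENNReal.ofReal_eq_zero] at h1
  have h3 : ‖conj (c k)‖ ^ 2 ≤ 0 := (Finset.single_le_sum (f := fun k => ‖conj (c k)‖ ^ 2)
    (fun _ _ => sq_nonneg _) hk).trans h1
  rw [RCLike.norm_conj] at h3
  exact norm_eq_zero.1 (pow_eq_zero_iff two_ne_zero |>.1 (le_antisymm h3 (sq_nonneg _)))

theorem diffusionPolyLp_eq_span (hX : IsDiffusionMeasureSpace ρ μ φ lam α) (p : ℝ≥0∞) (N : ℝ) :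
    diffusionPolyLp μ φ lam p N =
      (Submodule.span 𝕜 (hX.basisLp p '' {k | lam k ≤ N}) : Set (Lp 𝕜 p μ)) := by
  ext f
  constructor
  · rintro ⟨g, hg, hfg⟩
    have key : ∃ h ∈ Submodule.span 𝕜 (hX.basisLp p '' {k | lam k ≤ N}), h =ᵐ[μ] g := by
      clear hfg
      induction hg using Submodule.span_induction with
      | mem g hg =>
        obtain ⟨k, hk, rfl⟩ := hg
        exact ⟨_, Submodule.subset_span ⟨k, hk, rfl⟩, hX.coeFn_basisLp p k⟩
      | zero => exact ⟨0, zero_mem _, Lp.coeFn_zero _ _ _⟩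
      | add g₁ g₂ _ _ ih₁ ih₂ =>
        obtain ⟨h₁, hm₁, he₁⟩ := ih₁
        obtain ⟨h₂, hm₂, he₂⟩ := ih₂
        exact ⟨h₁ + h₂, add_mem hm₁ hm₂, (Lp.coeFn_add h₁ h₂).trans (he₁.add he₂)⟩
      | smul c g _ ih =>
        obtain ⟨h, hm, he⟩ := ih
        exact ⟨c • h, Submodule.smul_mem _ c hm, (Lp.coeFn_smul c h).trans (he.const_smul c)⟩
    obtain ⟨h, hm, he⟩ := key
    have : f = h := Lp.ext (hfg.trans he.symm)
    rw [this]
    exact hm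
  · intro hf
    have hf' : f ∈ Submodule.span 𝕜 (hX.basisLp p '' {k | lam k ≤ N}) := hf
    clear hf
    induction hf' using Submodule.span_induction with
    | mem f hf =>
      obtain ⟨k, hk, rfl⟩ := hf
      exact ⟨φ k, Submodule.subset_span ⟨k, hk, rfl⟩, hX.coeFn_basisLp p k⟩
    | zero => exact ⟨0, zero_mem _, Lp.coeFn_zero _ _ _⟩
    | add f₁ f₂ _ _ ih₁ ih₂ =>
      obtain ⟨g₁, hm₁, he₁⟩ := ih₁
      obtain ⟨g₂, hm₂, he₂⟩ := ih₂
      exact ⟨g₁ + g₂, add_mem hm₁ hm₂, (Lp.coeFn_add f₁ f₂).trans (he₁.add he₂)⟩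
    | smul c f _ ih =>
      obtain ⟨g, hm, he⟩ := ih
      exact ⟨c • g, Submodule.smul_mem _ c hm, (Lp.coeFn_smul c f).trans (he.const_smul c)⟩

theorem finrank_span_basisLp (hX : IsDiffusionMeasureSpace ρ μ φ lam α) (p : ℝ≥0∞) (N : ℝ) :
    Module.finrank 𝕜 (Submodule.span 𝕜 (hX.basisLp p '' {k | lam k ≤ N})) =
      {k | lam k ≤ N}.ncard := by
  have : Fintype {k | lam k ≤ N} := (hX.finite_setOf_lam_le N).fintype
  rw [Set.image_eq_range]
  refine (finrank_span_eq_card (b := fun k : {k | lam k ≤ N} => hX.basisLp p k)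
    ((hX.linearIndependent_basisLp p).comp _ Subtype.val_injective)).trans ?_
  rw [← Nat.card_eq_fintype_card]
  rfl

theorem finiteDimensional_span_basisLp (hX : IsDiffusionMeasureSpace ρ μ φ lam α) (p : ℝ≥0∞)
    (N : ℝ) : FiniteDimensional 𝕜 (Submodule.span 𝕜 (hX.basisLp p '' {k | lam k ≤ N})) :=
  FiniteDimensional.span_of_finite 𝕜 ((hX.finite_setOf_lam_le N).image _)

theorem natCast_le_rank_Lp (hX : IsDiffusionMeasureSpace ρ μ φ lam α) (p : ℝ≥0∞) (n : ℕ) :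
    (n : Cardinal) ≤ Module.rank 𝕜 (Lp 𝕜 p μ) :=
  Cardinal.natCast_lt_aleph0.le.trans (hX.linearIndependent_basisLp p).aleph0_le_rank

variable (p : ℝ≥0∞) [Fact (1 ≤ p)]

theorem integrable_conj_basis_mul (hX : IsDiffusionMeasureSpace ρ μ φ lam α) (k : ℕ)
    (f : Lp 𝕜 p μ) : Integrable (fun y => conj (φ k y) * f y) μ := by
  obtain ⟨B, hB⟩ := hX.exists_norm_basis_le k
  refine ((Lp.memLp f).integrable Fact.out).bdd_mul (c := B) ?_ (ae_of_all _ fun y => ?_)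
  · exact (RCLike.continuous_conj.measurable.comp (hX.measurable_basis k)).aestronglyMeasurable
  · rw [RCLike.norm_conj]
    exact hB y

/-- The `k`-th Fourier coefficient of an element of `Lₚ` with respect to the basis `φ`. -/
noncomputable def coeffLp (hX : IsDiffusionMeasureSpace ρ μ φ lam α) (k : ℕ) :
    Lp 𝕜 p μ →ₗ[𝕜] 𝕜 where
  toFun f := ∫ y, conj (φ k y) * f y ∂μ
  map_add' f g := by
    rw [← integral_add (hX.integrable_conj_basis_mul p k f) (hX.integrable_conj_basis_mul p k g)]
    refine integral_congr_ae ?_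
    filter_upwards [Lp.coeFn_add f g] with y hy
    rw [hy, Pi.add_apply, mul_add]
  map_smul' c f := by
    rw [RingHom.id_apply, smul_eq_mul, ← integral_const_mul]
    refine integral_congr_ae ?_
    filter_upwards [Lp.coeFn_smul c f] with y hy
    rw [hy, Pi.smul_apply, smul_eq_mul, mul_left_comm]

theorem coeffLp_basisLp (hX : IsDiffusionMeasureSpace ρ μ φ lam α) (j k : ℕ) :
    hX.coeffLp p k (hX.basisLp p j) = if k = j then 1 else 0 := by
  rw [← orthonormal_iff_ite.1 hX.orthonormal k j, L2.inner_def]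
  refine integral_congr_ae ?_
  filter_upwards [hX.coeFn_basisLp p j, (hX.memLp j).coeFn_toLp, (hX.memLp k).coeFn_toLp]
    with y h1 h2 h3
  rw [h1, h2, h3, RCLike.inner_apply, mul_comm]

/-- Smoothly truncated spectral projections: uniformly bounded operators of finite rank on `Lₚ` that
reproduce the diffusion polynomials of degree at most `N`. -/
theorem exists_reproducing_operator (hX : IsDiffusionMeasureSpace ρ μ φ lam α) :
    ∃ C > 0, ∀ N : ℝ, 1 ≤ N → ∃ F : Lp 𝕜 p μ →L[𝕜] Lp 𝕜 p μ, (∀ f, ‖F f‖ ≤ C * ‖f‖) ∧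
      (∀ f ∈ diffusionPolyLp μ φ lam p N, F f = f) ∧
      Module.rank 𝕜 (LinearMap.range (F : Lp 𝕜 p μ →ₗ[𝕜] Lp 𝕜 p μ)) ≤
        ({k | lam k ≤ 2 * N}.ncard : Cardinal) := by
  have hb : 0 < Real.exp (-1) := Real.exp_pos _
  obtain ⟨C, hC, hker⟩ := hX.exists_lintegral_cutoff_kernel_le hb
  refine ⟨C, hC, fun N hN => ?_⟩
  have hN0 : 0 < N := one_pos.trans_le hN
  set t := (N ^ 2)⁻¹ with htdef
  have ht : 0 < t := by positivity
  have ht1 : t ≤ 1 := inv_le_one_of_one_le₀ (one_le_pow₀ hN)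
  have hNt : N ^ 2 * t = 1 := mul_inv_cancel₀ (by positivity)
  set w : ℕ → ℝ := fun k => heatEigenvalue lam t k *
    cutoffDiv (Real.exp (-1)) (heatEigenvalue lam t k) with hw
  have hw1 : ∀ k, lam k ≤ N → w k = 1 := fun k hk => by
    refine mul_cutoffDiv_of_le hb (Real.exp_le_exp.2 ?_)
    have : lam k ^ 2 * t ≤ N ^ 2 * t := by
      gcongr
      exact hX.lam_nonneg k
    linarith
  set S := (hX.finite_setOf_lam_le (2 * N)).toFinset with hS
  have hw0 : ∀ k ∉ S, w k = 0 := fun k hk => by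
    have hk' : 2 * N < lam k := by simpa [hS] using hk
    rw [hw]
    refine mul_eq_zero_of_right _ (cutoffDiv_of_le hb ?_)
    have h1 : (2 * N) ^ 2 * t ≤ lam k ^ 2 * t := by gcongr
    have h2 : heatEigenvalue lam t k ≤ Real.exp (-1) * Real.exp (-3) := by
      rw [heatEigenvalue, ← Real.exp_add, Real.exp_le_exp]
      have : (2 * N) ^ 2 * t = 4 := by rw [mul_pow, mul_assoc, hNt]; norm_num
      linarith
    have h3 : Real.exp (-3) ≤ 1 / 2 := by
      rw [Real.exp_neg, one_div]
      refine inv_anti₀ two_pos ?_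
      linarith [Real.add_one_le_exp (3 : ℝ)]
    have h4 : Real.exp (-1) * Real.exp (-3) ≤ Real.exp (-1) * (1 / 2) := by gcongr
    linarith
  have hK : ∀ x y, spectralKernel φ w x y = ∑ k ∈ S, (w k : 𝕜) * φ k x * conj (φ k y) :=
    fun x y => tsum_eq_sum fun k hk => by rw [hw0 k hk]; simp
  have hKm : Measurable (Function.uncurry (spectralKernel φ w)) := by
    have : Function.uncurry (spectralKernel φ w) =
        fun z : X × X => ∑ k ∈ S, (w k : 𝕜) * φ k z.1 * conj (φ k z.2) := by
      ext z
      exact hK z.1 z.2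
    rw [this]
    exact Finset.measurable_fun_sum _ fun k _ =>
      (((hX.measurable_basis k).comp measurable_fst).const_mul _).mul
        (RCLike.continuous_conj.measurable.comp ((hX.measurable_basis k).comp measurable_snd))
  let F₀ : Lp 𝕜 p μ →ₗ[𝕜] Lp 𝕜 p μ :=
    ∑ k ∈ S, (w k : 𝕜) • (hX.coeffLp p k).smulRight (hX.basisLp p k)
  have hF₀ : ∀ f, F₀ f = ∑ k ∈ S, ((w k : 𝕜) * hX.coeffLp p k f) • hX.basisLp p k := fun f => by
    simp only [F₀, LinearMap.sum_apply, LinearMap.smul_apply, LinearMap.smulRight_apply, smul_smul]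
  have hFint : ∀ f : Lp 𝕜 p μ, F₀ f =ᵐ[μ] fun x => ∫ y, spectralKernel φ w x y * f y ∂μ := by
    intro f
    rw [hF₀]
    filter_upwards [hX.coeFn_sum_smul_basisLp p S fun k => (w k : 𝕜) * hX.coeffLp p k f] with x hx
    rw [hx]
    have h1 : ∀ y, spectralKernel φ w x y * f y =
        ∑ k ∈ S, (w k : 𝕜) * φ k x * (conj (φ k y) * f y) := fun y => by
      rw [hK, Finset.sum_mul]
      exact Finset.sum_congr rfl fun k _ => mul_assoc _ _ _
    simp_rw [h1]
    rw [integral_finsetSum _ fun k _ => (hX.integrable_conj_basis_mul p k f).const_mul _]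
    refine Finset.sum_congr rfl fun k _ => ?_
    rw [integral_const_mul, mul_right_comm]
    rfl
  have hbound : ∀ f, ‖F₀ f‖ ≤ C * ‖f‖ := by
    intro f
    have h1 : ‖F₀ f‖ₑ ≤ ENNReal.ofReal C * ‖f‖ₑ := by
      rw [Lp.enorm_def, Lp.enorm_def, eLpNorm_congr_ae (hFint f)]
      refine eLpNorm_integral_mul_le hKm (fun x => hker t ht ht1 x) (fun y => ?_)
        (Lp.stronglyMeasurable f).measurable Fact.out
      simp_rw [enorm_spectralKernel_symm φ w _ y]
      exact hker t ht ht1 y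
    rw [← ofReal_norm, ← ofReal_norm, ← ENNReal.ofReal_mul hC.le,
      ENNReal.ofReal_le_ofReal_iff (by positivity)] at h1
    exact h1
  refine ⟨F₀.mkContinuous C hbound, hbound, fun f hf => ?_, ?_⟩
  · rw [hX.diffusionPolyLp_eq_span] at hf
    have hle : Submodule.span 𝕜 (hX.basisLp p '' {k | lam k ≤ N}) ≤
        LinearMap.eqLocus F₀ LinearMap.id := by
      rw [Submodule.span_le]
      rintro _ ⟨j, hj, rfl⟩
      have hj' : lam j ≤ N := hj
      have hjS : j ∈ S := by simpa [hS] using (show lam j ≤ 2 * N by linarith)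
      change F₀ (hX.basisLp p j) = hX.basisLp p j
      rw [hF₀, Finset.sum_eq_single j]
      · rw [hX.coeffLp_basisLp p, if_pos rfl, hw1 j hj']
        simp
      · intro k _ hkj
        rw [hX.coeffLp_basisLp p, if_neg hkj]
        simp
      · exact fun h => absurd hjS h
    exact hle hf
  · have hle : LinearMap.range (F₀.mkContinuous C hbound : Lp 𝕜 p μ →ₗ[𝕜] Lp 𝕜 p μ) ≤
        Submodule.span 𝕜 (hX.basisLp p '' {k | lam k ≤ 2 * N}) := by
      rintro _ ⟨f, rfl⟩
      change F₀ f ∈ _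
      rw [hF₀]
      refine Submodule.sum_mem _ fun k hk =>
        Submodule.smul_mem _ _ (Submodule.subset_span ⟨k, ?_, rfl⟩)
      simpa [hS] using hk
    have := hX.finiteDimensional_span_basisLp p (2 * N)
    refine (Submodule.rank_mono hle).trans (le_of_eq ?_)
    rw [← Module.finrank_eq_rank, hX.finrank_span_basisLp]

end IsDiffusionMeasureSpace

end PolyLp

/-! ### Widths of Sobolev balls -/

theorem linearWidth_le_radius {𝕜 X : Type*} [RCLike 𝕜] [MeasurableSpace X] (p : ℝ≥0∞)
    [Fact (1 ≤ p)] (μ : Measure X) (φ : ℕ → X → 𝕜) (lam : ℕ → ℝ) (s r : ℝ) (n : ℕ) :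
    linearWidth 𝕜 n (sobolevBall μ φ lam p s r) ≤ ENNReal.ofReal r := by
  refine (iInf₂_le (0 : Lp 𝕜 p μ →L[𝕜] Lp 𝕜 p μ) (by simp)).trans (iSup₂_le fun f hf => ?_)
  have hf' : sobolevNorm μ φ lam p s f ≤ ENNReal.ofReal r := hf
  simpa using le_self_add.trans hf'

section SobolevWidths

variable {𝕜 X : Type*} [RCLike 𝕜] [TopologicalSpace X] [MeasurableSpace X] [BorelSpace X]
  {ρ : X → X → ℝ} {μ : Measure X} [IsProbabilityMeasure μ] {φ : ℕ → X → 𝕜} {lam : ℕ → ℝ} {α : ℝ}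
  (p : ℝ≥0∞) [Fact (1 ≤ p)]

namespace IsDiffusionMeasureSpace

/-- A Sobolev ball contains a ball of the space of diffusion polynomials of degree at most `2 ^ j`,
since such polynomials have zero approximation errors for all larger degrees. -/
theorem mem_sobolevBall_of_norm_le (hX : IsDiffusionMeasureSpace ρ μ φ lam α) {s : ℝ} (hs : 0 < s)
    {r : ℝ} (j : ℕ) {z : Lp 𝕜 p μ}
    (hz : z ∈ Submodule.span 𝕜 (hX.basisLp p '' {k | lam k ≤ 2 ^ j}))
    (hzn : ‖z‖ ≤ r / (1 + ((2 : ℝ) ^ j) ^ s)) : z ∈ sobolevBall μ φ lam p s r := by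
  have hpos : 0 < 1 + ((2 : ℝ) ^ j) ^ s := by positivity
  change sobolevNorm μ φ lam p s z ≤ ENNReal.ofReal r
  have hsup : ⨆ i : ℕ, ENNReal.ofReal (((2 : ℝ) ^ i) ^ s) *
      bestError z (diffusionPolyLp μ φ lam p (2 ^ i)) ≤
      ENNReal.ofReal (((2 : ℝ) ^ j) ^ s) * ‖z‖ₑ := by
    refine iSup_le fun i => ?_
    rw [hX.diffusionPolyLp_eq_span]
    rcases le_total j i with hji | hij
    · have hzi : z ∈ Submodule.span 𝕜 (hX.basisLp p '' {k | lam k ≤ 2 ^ i}) := by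
        refine Submodule.span_mono (Set.image_mono fun k hk => ?_) hz
        exact le_trans (show lam k ≤ 2 ^ j from hk) (pow_le_pow_right₀ one_le_two hji)
      have h0 : bestError z (Submodule.span 𝕜 (hX.basisLp p '' {k | lam k ≤ 2 ^ i}) :
          Set (Lp 𝕜 p μ)) ≤ 0 := (iInf₂_le z hzi).trans (by simp)
      rw [nonpos_iff_eq_zero.1 h0, mul_zero]
      exact zero_le
    · gcongr
      · exact one_le_two
      · exact (iInf₂_le 0 (Submodule.zero_mem _)).trans (by simp)
  calc sobolevNorm μ φ lam p s z ≤ ‖z‖ₑ + ENNReal.ofReal (((2 : ℝ) ^ j) ^ s) * ‖z‖ₑ :=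
        add_le_add le_rfl hsup
    _ = ENNReal.ofReal ((1 + ((2 : ℝ) ^ j) ^ s) * ‖z‖) := by
        rw [← ofReal_norm, ← ENNReal.ofReal_mul (by positivity),
          ← ENNReal.ofReal_add (by positivity) (by positivity)]
        congr 1; ring
    _ ≤ ENNReal.ofReal r := by
        refine ENNReal.ofReal_le_ofReal ?_
        rw [mul_comm]
        exact (le_div_iff₀ hpos).1 hzn

theorem exists_linearWidth_le_of_ncard_le (hX : IsDiffusionMeasureSpace ρ μ φ lam α) :
    ∃ C > 0, ∀ (s r : ℝ) (j n : ℕ), {k | lam k ≤ 2 * 2 ^ j}.ncard ≤ n →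
      linearWidth 𝕜 n (sobolevBall μ φ lam p s r) ≤
        ENNReal.ofReal (C * (r * ((2 : ℝ) ^ j) ^ (-s))) := by
  obtain ⟨C, hC, hF⟩ := hX.exists_reproducing_operator p
  refine ⟨1 + C, by positivity, fun s r j n hn => ?_⟩
  obtain ⟨F, hFb, hFr, hFrank⟩ := hF (2 ^ j) (one_le_pow₀ one_le_two)
  refine (iInf₂_le F (hFrank.trans (by exact_mod_cast hn))).trans (iSup₂_le fun f hf => ?_)
  have hf' : sobolevNorm μ φ lam p s f ≤ ENNReal.ofReal r := hf
  set P := diffusionPolyLp μ φ lam p (2 ^ j) with hP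
  have h1 : ENNReal.ofReal (((2 : ℝ) ^ j) ^ s) * bestError f P ≤ ENNReal.ofReal r :=
    (le_iSup (fun j : ℕ => ENNReal.ofReal (((2 : ℝ) ^ j) ^ s) *
      bestError f (diffusionPolyLp μ φ lam p (2 ^ j))) j).trans (le_add_self.trans hf')
  have h2 : ‖f - F f‖ₑ ≤ ENNReal.ofReal (1 + C) * bestError f P := by
    have hne : ENNReal.ofReal (1 + C) ≠ 0 := by simpa using by positivity
    rw [bestError, ENNReal.mul_iInf_of_ne hne ENNReal.ofReal_ne_top]
    refine le_iInf fun g => ?_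
    rw [ENNReal.mul_iInf_of_ne hne ENNReal.ofReal_ne_top]
    refine le_iInf fun hg => ?_
    have h3 : f - F f = (f - g) - F (f - g) := by
      rw [map_sub, hFr g hg]; abel
    rw [h3, ← ofReal_norm, ← ofReal_norm, ← ENNReal.ofReal_mul (by positivity)]
    refine ENNReal.ofReal_le_ofReal ((norm_sub_le _ _).trans ?_)
    linarith [hFb (f - g)]
  have hpos : 0 < ((2 : ℝ) ^ j) ^ s := by positivity
  have h4 : bestError f P ≤ ENNReal.ofReal (r * ((2 : ℝ) ^ j) ^ (-s)) := by
    rw [Real.rpow_neg (by positivity), ← div_eq_mul_inv, ENNReal.ofReal_div_of_pos hpos,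
      ENNReal.le_div_iff_mul_le (by left; simpa using hpos) (by left; exact ENNReal.ofReal_ne_top),
      mul_comm]
    exact h1
  refine h2.trans ((mul_le_mul_right h4 _).trans (le_of_eq ?_))
  rw [← ENNReal.ofReal_mul (by positivity)]

theorem exists_linearWidth_le (hX : IsDiffusionMeasureSpace ρ μ φ lam α) {s : ℝ} (hs : 0 < s) :
    ∃ C > 0, ∀ r : ℝ, 0 < r → ∀ n : ℕ, 1 ≤ n → linearWidth 𝕜 n (sobolevBall μ φ lam p s r) ≤
      ENNReal.ofReal (C * (r * (n : ℝ) ^ (-s / α))) := by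
  have hα := hX.alpha_pos
  obtain ⟨A, hA, hcard⟩ := hX.exists_ncard_le
  obtain ⟨C, hC, hlin⟩ := hX.exists_linearWidth_le_of_ncard_le p
  set D := A * 2 ^ α with hD
  have hD0 : 0 < D := by positivity
  refine ⟨(C * 2 ^ s + 1) * D ^ (s / α), by positivity, fun r hr n hn => ?_⟩
  have hn0 : (0 : ℝ) < n := by exact_mod_cast hn
  have hDn : D ^ (s / α) * (n : ℝ) ^ (-s / α) = (n / D) ^ (-s / α) := by
    rw [Real.div_rpow hn0.le hD0.le, neg_div, Real.rpow_neg hD0.le, div_inv_eq_mul, mul_comm]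
  have hpos : 0 < (n / D) ^ (-s / α) := by positivity
  rw [show (C * 2 ^ s + 1) * D ^ (s / α) * (r * (n : ℝ) ^ (-s / α)) =
    (C * 2 ^ s + 1) * (r * (D ^ (s / α) * (n : ℝ) ^ (-s / α))) by ring, hDn]
  rcases le_or_gt 1 (n / D) with h1 | h1
  · -- the largest dyadic degree whose operator has rank at most `n`
    obtain ⟨j, hj1, hj2⟩ := exists_nat_pow_near (x := (n / D) ^ α⁻¹) (y := (2 : ℝ))
      (Real.one_le_rpow h1 (by positivity)) one_lt_two
    have hrank : {k | lam k ≤ 2 * 2 ^ j}.ncard ≤ n := by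
      have h2 := hcard (2 * 2 ^ j) (by
        have : (1 : ℝ) ≤ 2 ^ j := one_le_pow₀ one_le_two
        linarith)
      have h3 : ((2 : ℝ) ^ j) ^ α ≤ n / D := by
        calc ((2 : ℝ) ^ j) ^ α ≤ ((n / D) ^ α⁻¹) ^ α := by gcongr
          _ = n / D := Real.rpow_inv_rpow (by positivity) hα.ne'
      have h4 : A * (2 * 2 ^ j : ℝ) ^ α ≤ n := by
        rw [Real.mul_rpow zero_le_two (by positivity), ← mul_assoc, ← hD]
        rw [le_div_iff₀ hD0] at h3
        linarith
      exact_mod_cast h2.trans h4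
    refine (hlin s r j n hrank).trans (ENNReal.ofReal_le_ofReal ?_)
    have h5 : ((2 : ℝ) ^ j) ^ (-s) ≤ 2 ^ s * (n / D) ^ (-s / α) := by
      calc ((2 : ℝ) ^ j) ^ (-s) = 2 ^ s * ((2 : ℝ) ^ (j + 1)) ^ (-s) := by
            rw [pow_succ, Real.mul_rpow (by positivity) zero_le_two, Real.rpow_neg zero_le_two s]
            have : (0 : ℝ) < 2 ^ s := by positivity
            field_simp
        _ ≤ 2 ^ s * ((n / D) ^ α⁻¹) ^ (-s) := by
            gcongr 2 ^ s * ?_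
            exact Real.rpow_le_rpow_of_nonpos (by positivity) hj2.le (by linarith)
        _ = 2 ^ s * (n / D) ^ (-s / α) := by
            rw [← Real.rpow_mul (by positivity)]
            congr 2; field_simp
    calc C * (r * ((2 : ℝ) ^ j) ^ (-s)) ≤ C * (r * (2 ^ s * (n / D) ^ (-s / α))) := by gcongr
      _ ≤ (C * 2 ^ s + 1) * (r * (n / D) ^ (-s / α)) := by
        have : 0 < r * (n / D) ^ (-s / α) := by positivity
        nlinarith
  · refine (linearWidth_le_radius p μ φ lam s r n).trans (ENNReal.ofReal_le_ofReal ?_)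
    have h2 : 1 ≤ (n / D) ^ (-s / α) :=
      Real.one_le_rpow_of_pos_of_le_one_of_nonpos (by positivity) h1.le
        (by rw [neg_div]; exact neg_nonpos.2 (by positivity))
    have h3 : r ≤ r * (n / D) ^ (-s / α) := le_mul_of_one_le_right hr.le h2
    have h4 : 0 < C * 2 ^ s * (r * (n / D) ^ (-s / α)) := by positivity
    linarith

/-- The common source of the lower bounds: a subspace of dimension `6 n` whose ball of radius
comparable to `r n ^ (-s / α)` lies in the Sobolev ball. -/
theorem exists_ball_subset_sobolevBall (hX : IsDiffusionMeasureSpace ρ μ φ lam α) {s : ℝ}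
    (hs : 0 < s) : ∃ c > 0, ∀ r : ℝ, 0 < r → ∀ n : ℕ, 1 ≤ n → ∃ Z : Submodule 𝕜 (Lp 𝕜 p μ),
      FiniteDimensional 𝕜 Z ∧ 6 * n ≤ Module.finrank 𝕜 Z ∧
      ∀ z ∈ Z, ‖z‖ ≤ c * (r * (n : ℝ) ^ (-s / α)) → z ∈ sobolevBall μ φ lam p s r := by
  have hα := hX.alpha_pos
  obtain ⟨c, hc, N₀, hN₀, hcard⟩ := hX.exists_le_ncard
  set E := N₀ + (6 / c) ^ α⁻¹ with hE
  have hE1 : 1 ≤ E := by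
    have : 0 < (6 / c) ^ α⁻¹ := by positivity
    linarith
  have hE0 : 0 < E := by linarith
  refine ⟨(2 * (2 * E) ^ s)⁻¹, by positivity, fun r hr n hn => ?_⟩
  have hn1 : (1 : ℝ) ≤ n := by exact_mod_cast hn
  have hn0 : (0 : ℝ) < n := by linarith
  have hnα : 1 ≤ (n : ℝ) ^ α⁻¹ := Real.one_le_rpow hn1 (by positivity)
  obtain ⟨i, hi1, hi2⟩ := exists_nat_pow_near (x := E * (n : ℝ) ^ α⁻¹) (y := (2 : ℝ))
    (by nlinarith) one_lt_two
  refine ⟨Submodule.span 𝕜 (hX.basisLp p '' {k | lam k ≤ 2 ^ (i + 1)}),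
    hX.finiteDimensional_span_basisLp p _, ?_, fun z hz hzn =>
      hX.mem_sobolevBall_of_norm_le p hs (i + 1) hz (hzn.trans ?_)⟩
  · rw [hX.finrank_span_basisLp]
    have h1 : N₀ ≤ 2 ^ (i + 1) := by
      have : 0 < (6 / c) ^ α⁻¹ := by positivity
      nlinarith
    have h2 : (6 / c) ^ α⁻¹ * (n : ℝ) ^ α⁻¹ ≤ 2 ^ (i + 1) := by
      refine le_trans ?_ hi2.le
      gcongr
      linarith
    have h3 : 6 / c * n ≤ ((2 : ℝ) ^ (i + 1)) ^ α := by
      calc 6 / c * n = ((6 / c) ^ α⁻¹ * (n : ℝ) ^ α⁻¹) ^ α := by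
            rw [← Real.mul_rpow (by positivity) hn0.le, Real.rpow_inv_rpow (by positivity) hα.ne']
        _ ≤ _ := by gcongr
    have h4 : (6 * n : ℝ) ≤ {k | lam k ≤ 2 ^ (i + 1)}.ncard := by
      refine le_trans ?_ (hcard _ h1)
      calc (6 * n : ℝ) = c * (6 / c * n) := by field_simp
        _ ≤ _ := by gcongr
    exact_mod_cast h4
  · have h1 : (2 : ℝ) ^ (i + 1) ≤ 2 * E * (n : ℝ) ^ α⁻¹ := by
      rw [pow_succ]; linarith
    have h2 : ((2 : ℝ) ^ (i + 1)) ^ s ≤ (2 * E) ^ s * (n : ℝ) ^ (s / α) := by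
      calc ((2 : ℝ) ^ (i + 1)) ^ s ≤ (2 * E * (n : ℝ) ^ α⁻¹) ^ s := by gcongr
        _ = _ := by
          rw [Real.mul_rpow (by positivity) (by positivity), ← Real.rpow_mul hn0.le]
          congr 2; field_simp
    have h3 : (1 : ℝ) ≤ ((2 : ℝ) ^ (i + 1)) ^ s :=
      Real.one_le_rpow (one_le_pow₀ one_le_two) hs.le
    rw [le_div_iff₀ (by positivity)]
    have h4 : (n : ℝ) ^ (-s / α) * (n : ℝ) ^ (s / α) = 1 := by
      rw [← Real.rpow_add hn0, neg_div, neg_add_cancel, Real.rpow_zero]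
    calc (2 * (2 * E) ^ s)⁻¹ * (r * (n : ℝ) ^ (-s / α)) * (1 + ((2 : ℝ) ^ (i + 1)) ^ s)
        ≤ (2 * (2 * E) ^ s)⁻¹ * (r * (n : ℝ) ^ (-s / α)) *
          (2 * ((2 * E) ^ s * (n : ℝ) ^ (s / α))) := by
          gcongr
          linarith
      _ = r * ((n : ℝ) ^ (-s / α) * (n : ℝ) ^ (s / α)) := by field_simp
      _ = r := by rw [h4, mul_one]

end IsDiffusionMeasureSpace

end SobolevWidths

theorem theorem4p3 {𝕜 X : Type*} [RCLike 𝕜] [TopologicalSpace X] [MeasurableSpace X] [BorelSpace X]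
    (ρ : X → X → ℝ) (μ : Measure X) [IsProbabilityMeasure μ] (φ : ℕ → X → 𝕜) (lam : ℕ → ℝ) (α : ℝ)
    (hX : IsDiffusionMeasureSpace ρ μ φ lam α) (hprod : StrongProduct φ lam)
    (p : ℝ≥0∞) [Fact (1 ≤ p)] (s : ℝ) (hs : 0 < s) :
    ∃ c C : ℝ, 0 < c ∧ 0 < C ∧ ∀ r : ℝ, 0 < r → ∀ n : ℕ, 1 ≤ n →
      kolmogorovWidth 𝕜 n (sobolevBall μ φ lam p s r) ∈
        Set.Icc (ENNReal.ofReal (c * (r * (n : ℝ) ^ (-s / α))))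
          (ENNReal.ofReal (C * (r * (n : ℝ) ^ (-s / α)))) ∧
      linearWidth 𝕜 n (sobolevBall μ φ lam p s r) ∈
        Set.Icc (ENNReal.ofReal (c * (r * (n : ℝ) ^ (-s / α))))
          (ENNReal.ofReal (C * (r * (n : ℝ) ^ (-s / α)))) ∧
      gelfandWidth 𝕜 n (sobolevBall μ φ lam p s r) ∈
        Set.Icc (ENNReal.ofReal (c * (r * (n : ℝ) ^ (-s / α))))
          (ENNReal.ofReal (C * (r * (n : ℝ) ^ (-s / α)))) ∧
      bernsteinWidth 𝕜 n (sobolevBall μ φ lam p s r) ∈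
        Set.Icc (ENNReal.ofReal (c * (r * (n : ℝ) ^ (-s / α))))
          (ENNReal.ofReal (C * (r * (n : ℝ) ^ (-s / α)))) := by
  obtain ⟨C, hC, hup⟩ := hX.exists_linearWidth_le p hs
  obtain ⟨c, hc, hlow⟩ := hX.exists_ball_subset_sobolevBall p hs
  refine ⟨c / 10, C, by positivity, hC, fun r hr n hn => ?_⟩
  obtain ⟨Z, hZfin, hZdim, hZ⟩ := hlow r hr n hn
  have hpos : 0 ≤ c * (r * (n : ℝ) ^ (-s / α)) := by positivity
  set Y := sobolevBall μ φ lam p s r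
  have hle : ENNReal.ofReal (c / 10 * (r * (n : ℝ) ^ (-s / α))) ≤
      ENNReal.ofReal (c * (r * (n : ℝ) ^ (-s / α))) :=
    ENNReal.ofReal_le_ofReal (by rw [div_mul_eq_mul_div]; linarith)
  have hL := hup r hr n hn
  have hB := hle.trans (le_bernsteinWidth (n := n) hpos Z (by omega) hZ)
  have hBG := bernsteinWidth_le_gelfandWidth (𝕜 := 𝕜) n Y
  have hGL := gelfandWidth_le_linearWidth (𝕜 := 𝕜) n Y
  have hK := le_kolmogorovWidth hn hpos Z hZdim hZ
  rw [← div_mul_eq_mul_div] at hK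
  exact ⟨⟨hK, (kolmogorovWidth_le_linearWidth (hX.natCast_le_rank_Lp p) n Y).trans hL⟩,
    ⟨hB.trans (hBG.trans hGL), hL⟩, ⟨hB.trans hBG, hGL.trans hL⟩, ⟨hB, (hBG.trans hGL).trans hL⟩⟩
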